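/- Let $R>0$ and let $D_R\subset\mathbb R^2$ be the closed disk of radius $R$ with a smooth Riemannian metric $g$ which in polar coordinates reads $g=a(r)^2\,dr^2+r^2\,d\theta^2$, where $a>0$ on $[0,R]$ and $a(r)=1+r^2\tilde a(r^2)$ for some $\tilde a\in C^\infty([0,R^2])$ (a Herglotz disk). Put $e_r=a(r)^{-1}\partial_r$, $e_\theta=r^{-1}\partial_\theta$, and give a unit vector at the boundary point $Re^{i\theta}$ the coordinates $(\theta,\alpha)$ if it equals $-\cos\alpha\,e_r-\sin\alpha\,e_\theta$. Let $\tau(x,v)$ be the exit time of the unit speed geodesic issued from $(x,v)$, let $\varphi_t$ be the geodesic flow, and let $S$ be the scattering relation on unit vectors at the boundary: $S(x,v)=\varphi_{\tau(x,v)}(x,v)$ if $v$ points inward or is tangent to the boundary, $S(x,v)=\varphi_{-\tau(x,-v)}(x,v)$ if $v$ points outward or is tangent. Then there is a unique continuous function $\varsigma:\mathbb R\to\mathbb R$ with $\varsigma(0)=0$ (the scattering function) such that $$S(\theta,\alpha)=(\theta+\pi+2\varsigma(\alpha),\ \pi-\alpha)\qquad\text{for all }\theta,\alpha\in\mathbb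 R ,$$ it is differentiable, and $(D_R,g)$ is simple if and only if $\varsigma'(\alpha)>0$ for all $\alpha\in[-\pi/2,\pi/2]$. Here a surface is simple if its boundary is strictly convex (positive definite second fundamental form), exit times are bounded, and it has no conjugate points, i.e. there are no unit speed geodesic $\gamma$, times $t_0<t_1$ and nontrivial solution $j$ of $\ddot j+K(\gamma)j=0$ with $j(t_0)=j(t_1)=0$, $K$ being the Gaussian curvature. -/

import Mathlib

open Set Real
open scoped ENNReal NNReal ContDiff Matrix

noncomputable section

namespace Herglotz

/-- The coordinate plane, with its Euclidean norm. -/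
abbrev Plane := EuclideanSpace ℝ (Fin 2)

/-! ### Riemannian geometry in a coordinate domain

A surface (with boundary) is a closed region `M` of the plane, with a Riemannian metric given by
its matrix of coefficients `g x i j = g_x(∂_i, ∂_j)`. Derivatives on `M` are taken within `M`, so
nothing depends on the values of `g` outside `M`. -/

/-- The inner product `g_x(v, w)`. -/
def inn (g : Plane → Matrix (Fin 2) (Fin 2) ℝ) (x v w : Plane) : ℝ :=
  ∑ i, ∑ j, g x i j * v i * w j

/-- The partial derivative `∂_k f` at `x`, within `M`. -/
def pd (M : Set Plane) (k : Fin 2) (f : Plane → ℝ) (x : Plane) : ℝ :=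
  fderivWithin ℝ f M x (EuclideanSpace.single k 1)

/-- The Christoffel symbol `Γ^l_{ij}` of the Levi-Civita connection. -/
def christoffel (M : Set Plane) (g : Plane → Matrix (Fin 2) (Fin 2) ℝ) (l i j : Fin 2)
    (x : Plane) : ℝ :=
  (1 / 2) * ∑ m, (g x)⁻¹ l m *
    (pd M i (fun y => g y m j) x + pd M j (fun y => g y m i) x - pd M m (fun y => g y i j) x)

/-- The vector `Γ_x(v, w)` with components `∑ Γ^l_{ij} v^i w^j`. -/
def christoffelVec (M : Set Plane) (g : Plane → Matrix (Fin 2) (Fin 2) ℝ) (x v w : Plane) :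
    Plane :=
  WithLp.toLp 2 fun l => ∑ i, ∑ j, christoffel M g l i j x * v i * w j

/-- The component `R^l_{kij}` of the curvature tensor, `R(∂_i, ∂_j) ∂_k = R^l_{kij} ∂_l`. -/
def riemann (M : Set Plane) (g : Plane → Matrix (Fin 2) (Fin 2) ℝ) (l k i j : Fin 2)
    (x : Plane) : ℝ :=
  pd M i (christoffel M g l j k) x - pd M j (christoffel M g l i k) x
    + ∑ m, (christoffel M g l i m x * christoffel M g m j k x
      - christoffel M g l j m x * christoffel M g m i k x)

/-- The Gaussian curvature `K = g(R(∂_0, ∂_1) ∂_1, ∂_0) / det g`. -/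
def gaussCurvature (M : Set Plane) (g : Plane → Matrix (Fin 2) (Fin 2) ℝ) (x : Plane) : ℝ :=
  (∑ l, g x 0 l * riemann M g l 1 0 1 x) / (g x).det

/-- The unit tangent bundle `SM`. -/
def unitTangent (M : Set Plane) (g : Plane → Matrix (Fin 2) (Fin 2) ℝ) : Set (Plane × Plane) :=
  {p | p.1 ∈ M ∧ inn g p.1 p.2 p.2 = 1}

/-- `t ↦ (γ t, w t)`, `t ∈ I`, is an orbit of the geodesic flow on `SM`: `γ` is a unit speed
geodesic of `M` and `w` is its velocity. -/
def IsGeodesicOn (M : Set Plane) (g : Plane → Matrix (Fin 2) (Fin 2) ℝ) (γ w : ℝ → Plane)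
    (I : Set ℝ) : Prop :=
  ∀ t ∈ I, (γ t, w t) ∈ unitTangent M g ∧ HasDerivWithinAt γ (w t) I t ∧
    HasDerivWithinAt w (-christoffelVec M g (γ t) (w t) (w t)) I t

/-- The exit time `τ(x, v) ∈ [0, ∞]`: the supremum of the times up to which the geodesic issued
from `(x, v)` exists in `M`. -/
def exitTime (M : Set Plane) (g : Plane → Matrix (Fin 2) (Fin 2) ℝ) (x v : Plane) : ℝ≥0∞ :=
  ⨆ T ∈ {T : ℝ≥0 | ∃ γ w : ℝ → Plane,
    IsGeodesicOn M g γ w (Icc 0 (T : ℝ)) ∧ γ 0 = x ∧ w 0 = v}, (T : ℝ≥0∞)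

/-- `M` is non-trapping: exit times are bounded. -/
def IsNonTrapping (M : Set Plane) (g : Plane → Matrix (Fin 2) (Fin 2) ℝ) : Prop :=
  (⨆ p ∈ unitTangent M g, exitTime M g p.1 p.2) < ⊤

/-- The boundary is strictly convex: the second fundamental form `II(v, v) = -g(∇_v ν, v)`, with
`ν` the inward unit normal, is positive definite on the tangent spaces of the boundary. Here `ν` is
a vector field on `M` whose restriction to the boundary is the inward unit normal. -/
def IsStrictlyConvex (M : Set Plane) (g : Plane → Matrix (Fin 2) (Fin 2) ℝ) (ν : Plane → Plane) :
    Prop :=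
  ∀ x ∈ frontier M, ∀ v : Plane, v ≠ 0 → inn g x v (ν x) = 0 →
    0 < -inn g x (fderivWithin ℝ ν M x v + christoffelVec M g x v (ν x)) v

/-- There is a pair of points of `M` conjugate along a geodesic of `M`: some nontrivial solution
of the Jacobi equation `j'' + K(γ) j = 0` vanishes at two times `t₀ < t₁`. -/
def HasConjugatePoints (M : Set Plane) (g : Plane → Matrix (Fin 2) (Fin 2) ℝ) : Prop :=
  ∃ (t₀ t₁ : ℝ) (γ w : ℝ → Plane) (j j' : ℝ → ℝ), t₀ < t₁ ∧
    IsGeodesicOn M g γ w (Icc t₀ t₁) ∧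
    (∀ t ∈ Icc t₀ t₁, HasDerivWithinAt j (j' t) (Icc t₀ t₁) t ∧
      HasDerivWithinAt j' (-(gaussCurvature M g (γ t) * j t)) (Icc t₀ t₁) t) ∧
    (∃ t ∈ Icc t₀ t₁, j t ≠ 0) ∧ j t₀ = 0 ∧ j t₁ = 0

/-- A surface is simple if it has strictly convex boundary, is non-trapping and has no conjugate
points. -/
def IsSimple (M : Set Plane) (g : Plane → Matrix (Fin 2) (Fin 2) ℝ) (ν : Plane → Plane) : Prop :=
  IsStrictlyConvex M g ν ∧ IsNonTrapping M g ∧ ¬ HasConjugatePoints M g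

/-- The graph `S(x, v) = (x', v')` of the scattering relation on `∂SM`:
`S(x, v) = φ_{τ(x, v)}(x, v)` if `g(v, ν) ≥ 0`, and `S(x, v) = φ_{-τ(x, -v)}(x, v)` if
`g(v, ν) ≤ 0`, where `φ` is the geodesic flow. -/
def Scatters (M : Set Plane) (g : Plane → Matrix (Fin 2) (Fin 2) ℝ) (ν : Plane → Plane)
    (x v x' v' : Plane) : Prop :=
  x ∈ frontier M ∧ inn g x v v = 1 ∧
  (0 ≤ inn g x v (ν x) → ∃ (T : ℝ≥0) (γ w : ℝ → Plane), exitTime M g x v = T ∧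
    IsGeodesicOn M g γ w (Icc 0 (T : ℝ)) ∧ γ 0 = x ∧ w 0 = v ∧ γ T = x' ∧ w T = v') ∧
  (inn g x v (ν x) ≤ 0 → ∃ (T : ℝ≥0) (γ w : ℝ → Plane), exitTime M g x (-v) = T ∧
    IsGeodesicOn M g γ w (Icc (-(T : ℝ)) 0) ∧ γ 0 = x ∧ w 0 = v ∧
    γ (-(T : ℝ)) = x' ∧ w (-(T : ℝ)) = v')

/-! ### Herglotz disks -/

/-- `a` is the radial profile of a smooth rotation invariant metric `a(r)² dr² + r² dθ²` on the
closed disk of radius `R`: such a metric is smooth at the origin exactly when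
`a(r) = 1 + r² f(r²)` with `f` smooth. -/
structure IsHerglotzProfile (R : ℝ) (a : ℝ → ℝ) : Prop where
  radius_pos : 0 < R
  pos : ∀ r ∈ Icc 0 R, 0 < a r
  smooth : ∃ f : ℝ → ℝ, ContDiffOn ℝ ∞ f (Icc 0 (R ^ 2)) ∧
    ∀ r ∈ Icc 0 R, a r = 1 + r ^ 2 * f (r ^ 2)

/-- The closed disk of radius `R`. -/
abbrev disk (R : ℝ) : Set Plane := Metric.closedBall 0 R

/-- The metric `a(r)² dr² + r² dθ²` in Cartesian coordinates. Since `dr = (∑ x_i dx_i) / r` and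
`r² dθ² = ∑ dx_i² - dr²`, its coefficients are `δ_ij + (a(r)² - 1) x_i x_j / r²`, with value `δ_ij`
at the origin. -/
def metric (a : ℝ → ℝ) (x : Plane) : Matrix (Fin 2) (Fin 2) ℝ :=
  Matrix.of fun i j => (if i = j then 1 else 0) + (a ‖x‖ ^ 2 - 1) / ‖x‖ ^ 2 * (x i * x j)

/-- Polar coordinates. -/
def polar (r θ : ℝ) : Plane := !₂[r * cos θ, r * sin θ]

/-- The pullback of `metric a` by polar coordinates is `a(r)² dr² + r² dθ²`: here
`ρ ∂_r + σ ∂_θ` is sent to the vector `ρ (cos θ, sin θ) + σ r (-sin θ, cos θ)`. -/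
theorem inn_metric_polar (a : ℝ → ℝ) {r : ℝ} (hr : 0 < r) (θ ρ σ : ℝ) :
    inn (metric a) (polar r θ)
      !₂[ρ * cos θ - σ * (r * sin θ), ρ * sin θ + σ * (r * cos θ)]
      !₂[ρ * cos θ - σ * (r * sin θ), ρ * sin θ + σ * (r * cos θ)]
      = a r ^ 2 * ρ ^ 2 + r ^ 2 * σ ^ 2 := by
  have hn : ‖polar r θ‖ = r := by
    rw [EuclideanSpace.norm_eq, Real.sqrt_eq_iff_mul_self_eq (by positivity) hr.le]
    simp [polar, Fin.sum_univ_two]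
    linear_combination (r ^ 2) * Real.sin_sq_add_cos_sq θ
  have hs : sin θ ^ 2 = 1 - cos θ ^ 2 := Real.sin_sq θ
  simp only [inn, metric, hn, Fin.sum_univ_two, Matrix.of_apply]
  simp [polar]
  field_simp
  have h4 : sin θ ^ 4 = (1 - cos θ ^ 2) ^ 2 := by rw [← hs]; ring
  ring_nf
  simp only [h4, hs]
  ring

/-- The unit vector field `e_r = a(r)⁻¹ ∂_r`, off the origin. -/
def er (a : ℝ → ℝ) (x : Plane) : Plane := (a ‖x‖ * ‖x‖)⁻¹ • x

/-- The unit vector field `e_θ = r⁻¹ ∂_θ`, off the origin. -/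
def eθ (x : Plane) : Plane := ‖x‖⁻¹ • !₂[-x 1, x 0]

/-- The inward unit normal of the disk, `-e_r`. -/
def normal (a : ℝ → ℝ) (x : Plane) : Plane := -er a x

/-- The vector `v(α) = -cos α e_r - sin α e_θ` at `x`. -/
def fan (a : ℝ → ℝ) (x : Plane) (α : ℝ) : Plane := -(cos α • er a x) - sin α • eθ x

/-- `ς` is the scattering function: in the fan-beam coordinates `(θ, α)` of `∂SM`, the scattering
relation is `S(θ, α) = (θ + π + 2 ς(α), π - α)`. As this fixes `ς(α)` only modulo `π`, `ς` is
the continuous determination with `ς(0) = 0`. -/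
structure IsScatteringFunction (R : ℝ) (a ς : ℝ → ℝ) : Prop where
  cont : Continuous ς
  zero : ς 0 = 0
  scatters : ∀ θ α : ℝ, Scatters (disk R) (metric a) (normal a)
    (polar R θ) (fan a (polar R θ) α)
    (polar R (θ + π + 2 * ς α)) (fan a (polar R (θ + π + 2 * ς α)) (π - α))

end Herglotz

end

noncomputable section

namespace Herglotz

/-! Identify the plane with `ℂ`, and write `t = |x|²` and `a = 1 + t f(t)`. Along a unit speed
geodesic `x` with velocity `v`, the angular momentum `L` is constant, and the abscissa `s = a ⟨x,
v⟩` satisfies `s² + L² = |x|²` and `ds/dt = 1/a`. Moreover `x = u (s - iL)` with `u = a v - i L f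
x`, and `du/dt = i (L f / a) u`. Hence every geodesic is explicit in the parameter `s`: it is
`e^{i(φ + phase f L s)} (s - iL)`, a Euclidean line under a progressive rotation (`travel_abscissa`,
`twist_eq`, `isGeodesicOn_lineCurve`).

A maximal geodesic runs over `-S ≤ s ≤ S` with `L² + S² = R²`. The boundary vector of angle `α` has
`L = -R sin α` and `s = -R cos α`. Comparing arguments at the two ends gives `ς(α) = α + phase f (-R
sin α) (R cos α)`, which is `scatteringAngle`. The scattering relation determines `ς` modulo `π`,
and continuity with `ς(0) = 0` does the rest.

Varying the explicit family produces all normal Jacobi fields: the variation in `φ` has normal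
component `s`, the variation in `L` has normal component `J = jacobi f f₁ L s`, and `s`, `J` have
Wronskian `1` in the time variable. Therefore `d(J/s)/ds = a/s² > 0`. As `J` is even in `s` and
`J(0) < 0`, its sign at the boundary decides everything. If `J(S) < 0`, no nontrivial combination of
`s` and `J` vanishes twice; if `J(S) ≥ 0` with `S > 0`, then `J` vanishes at some pair `±s`. The
chain rule gives `ς'(α) = -J(L, S)`, so `ς' > 0` says exactly that there are no conjugate points.
The other two conditions of simplicity hold for every Herglotz disk (`isStrictlyConvex`,
`isNonTrapping`). -/

/-! ### Extension of the radial profile to the line -/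

/-- A `C^n` function on a compact interval is the restriction of a `C^n` function on the line. -/
theorem exists_contDiff_eqOn_Icc {a b : ℝ} (hab : a < b) (n : ℕ) :
    ∀ f : ℝ → ℝ, ContDiffOn ℝ n f (Icc a b) →
      ∃ g : ℝ → ℝ, ContDiff ℝ n g ∧ EqOn g f (Icc a b) := by
  induction n with
  | zero =>
    intro f hf
    refine ⟨IccExtend hab.le ((Icc a b).domRestrict f), ?_, fun x hx => ?_⟩
    · have := hf.continuousOn.domRestrict.Icc_extend' (h := hab.le)
      exact contDiff_zero.2 this
    · rw [IccExtend_of_mem _ _ hx]; rfl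
  | succ n ih =>
    intro f hf
    have hu := uniqueDiffOn_Icc hab
    rw [Nat.cast_add, Nat.cast_one, contDiffOn_succ_iff_derivWithin hu] at hf
    obtain ⟨hd, -, hc⟩ := hf
    obtain ⟨g, hg, hgf⟩ := ih _ hc
    -- The extension is the primitive, with value `f a` at `a`, of an extension `g` of the
    -- derivative.
    have hG : ∀ x, HasDerivAt (fun x => f a + ∫ t in a..x, g t) (g x) x := fun x =>
      (intervalIntegral.integral_hasDerivAt_right (hg.continuous.intervalIntegrable _ _)
        (hg.continuous.stronglyMeasurableAtFilter _ _) hg.continuous.continuousAt).const_add _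
    refine ⟨fun x => f a + ∫ t in a..x, g t, ?_, ?_⟩
    · rw [Nat.cast_add, Nat.cast_one, contDiff_succ_iff_deriv]
      refine ⟨fun x => (hG x).differentiableAt, by simp, ?_⟩
      rwa [funext fun x => (hG x).deriv]
    · refine (convex_Icc a b).eqOn_of_fderivWithin_eq (𝕜 := ℝ)
        (fun x _ => (hG x).differentiableAt.differentiableWithinAt) hd hu ?_
        (left_mem_Icc.2 hab.le) (by simp)
      intro x hx
      rw [(hG x).hasDerivWithinAt.hasFDerivWithinAt.fderivWithin (hu x hx),
        ← toSpanSingleton_derivWithin, hgf hx]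

/-- The radial profile `a` is `1 + r² f(r²)` on `[0, R]`, where `f`, defined on the line, is twice
differentiable with derivatives `f₁` and `f₂`. -/
structure IsGlobalProfile (R : ℝ) (a f f₁ f₂ : ℝ → ℝ) : Prop where
  radius_pos : 0 < R
  pos : ∀ t ∈ Icc 0 (R ^ 2), 0 < 1 + t * f t
  hasDerivAt : ∀ t, HasDerivAt f (f₁ t) t
  hasDerivAt' : ∀ t, HasDerivAt f₁ (f₂ t) t
  eq : ∀ r ∈ Icc 0 R, a r = 1 + r ^ 2 * f (r ^ 2)

theorem IsHerglotzProfile.exists_isGlobalProfile {R : ℝ} {a : ℝ → ℝ}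
    (h : IsHerglotzProfile R a) : ∃ f f₁ f₂, IsGlobalProfile R a f f₁ f₂ := by
  have hR := h.radius_pos
  obtain ⟨f, hf, hfa⟩ := h.smooth
  obtain ⟨g, hg, hgf⟩ := exists_contDiff_eqOn_Icc (a := 0) (b := R ^ 2) (by positivity) 2 f
    (hf.of_le (WithTop.coe_le_coe.2 le_top))
  have hg' : ContDiff ℝ 1 (deriv g) :=
    ((contDiff_succ_iff_deriv (n := 1)).1 (by simpa [one_add_one_eq_two] using hg)).2.2
  have heq : ∀ r ∈ Icc 0 R, a r = 1 + r ^ 2 * g (r ^ 2) := fun r hr => by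
    rw [hfa r hr, hgf ⟨by positivity, pow_le_pow_left₀ hr.1 hr.2 2⟩]
  refine ⟨g, deriv g, deriv (deriv g), hR, fun t ht => ?_,
    fun t => (hg.differentiable (by norm_num) t).hasDerivAt,
    fun t => (hg'.differentiable (by norm_num) t).hasDerivAt, heq⟩
  have hs : √t ∈ Icc 0 R := ⟨sqrt_nonneg t, sqrt_le_iff.2 ⟨hR.le, ht.2⟩⟩
  have := h.pos _ hs
  rwa [heq _ hs, sq_sqrt ht.1] at this

/-! ### The metric in Cartesian coordinates -/

/-- The square of the Euclidean norm, as a polynomial in the coordinates. -/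
def nsq (x : Plane) : ℝ := x 0 ^ 2 + x 1 ^ 2

theorem norm_sq_eq_nsq (x : Plane) : ‖x‖ ^ 2 = nsq x := by
  rw [EuclideanSpace.norm_sq_eq, Fin.sum_univ_two, nsq]; simp

theorem nsq_nonneg (x : Plane) : 0 ≤ nsq x := by unfold nsq; positivity

theorem mem_disk_iff {R : ℝ} (hR : 0 ≤ R) (x : Plane) : x ∈ disk R ↔ nsq x ≤ R ^ 2 := by
  rw [disk, mem_closedBall_zero_iff, ← norm_sq_eq_nsq, sq_le_sq₀ (norm_nonneg _) hR]

theorem hasFDerivAt_coord (i : Fin 2) (x : Plane) :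
    HasFDerivAt (fun y : Plane => y i) (EuclideanSpace.proj (𝕜 := ℝ) i) x :=
  (EuclideanSpace.proj (𝕜 := ℝ) i).hasFDerivAt

theorem hasFDerivAt_nsq (x : Plane) :
    HasFDerivAt nsq ((2 * x 0) • EuclideanSpace.proj (𝕜 := ℝ) (0 : Fin 2)
      + (2 * x 1) • EuclideanSpace.proj (𝕜 := ℝ) (1 : Fin 2)) x := by
  refine (((hasFDerivAt_coord 0 x).pow 2).add ((hasFDerivAt_coord 1 x).pow 2)).congr_fderiv ?_
  simp

theorem hasFDerivAt_comp_nsq {φ : ℝ → ℝ} {φ' : ℝ} {x : Plane} (h : HasDerivAt φ φ' (nsq x)) :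
    HasFDerivAt (fun y => φ (nsq y)) (φ' • ((2 * x 0) • EuclideanSpace.proj (𝕜 := ℝ) (0 : Fin 2)
      + (2 * x 1) • EuclideanSpace.proj (𝕜 := ℝ) (1 : Fin 2))) x :=
  h.comp_hasFDerivAt x (hasFDerivAt_nsq x)

theorem uniqueDiffOn_disk {R : ℝ} (hR : 0 < R) : UniqueDiffOn ℝ (disk R) :=
  uniqueDiffOn_convex (convex_closedBall _ _)
    ((Metric.nonempty_ball.2 hR).mono Metric.ball_subset_interior_closedBall)

theorem pd_of_hasFDerivAt {R : ℝ} (hR : 0 < R) {h g : Plane → ℝ} {g' : Plane →L[ℝ] ℝ} {x : Plane}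
    (hx : x ∈ disk R) (hhg : EqOn h g (disk R)) (hg : HasFDerivAt g g' x) (k : Fin 2) :
    pd (disk R) k h x = g' (EuclideanSpace.single k 1) := by
  rw [pd, fderivWithin_congr hhg (hhg hx),
    hg.hasFDerivWithinAt.fderivWithin (uniqueDiffOn_disk hR x hx)]

/-- The matrix `δ_ij + F(|x|²) x_i x_j`. -/
def radialMetric (F : ℝ → ℝ) (x : Plane) : Matrix (Fin 2) (Fin 2) ℝ :=
  Matrix.of fun i j => (if i = j then 1 else 0) + F (nsq x) * (x i * x j)

theorem det_radialMetric (F : ℝ → ℝ) (x : Plane) :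
    (radialMetric F x).det = 1 + nsq x * F (nsq x) := by
  rw [Matrix.det_fin_two]
  simp [radialMetric]
  rw [nsq]
  ring

/-- `a² = 1 + t F(t)` for `a = 1 + t f(t)`. -/
def coeff (f : ℝ → ℝ) (t : ℝ) : ℝ := 2 * f t + t * f t ^ 2

/-- The derivative of `coeff f`. -/
def coeff₁ (f f₁ : ℝ → ℝ) (t : ℝ) : ℝ := 2 * f₁ t + (f t ^ 2 + t * (2 * f t * f₁ t))

/-- The second derivative of `coeff f`. -/
def coeff₂ (f f₁ f₂ : ℝ → ℝ) (t : ℝ) : ℝ :=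
  2 * f₂ t + (2 * f t * f₁ t + (2 * f t * f₁ t + t * (2 * f₁ t * f₁ t + 2 * f t * f₂ t)))

section

variable {R : ℝ} {a f f₁ f₂ : ℝ → ℝ}

theorem one_add_mul_coeff (f : ℝ → ℝ) (t : ℝ) : 1 + t * coeff f t = (1 + t * f t) ^ 2 := by
  rw [coeff]; ring

theorem IsGlobalProfile.hasDerivAt_coeff (h : IsGlobalProfile R a f f₁ f₂) (t : ℝ) :
    HasDerivAt (coeff f) (coeff₁ f f₁ t) t := by
  refine (((h.hasDerivAt t).const_mul 2).add
    ((hasDerivAt_id t).mul ((h.hasDerivAt t).pow 2))).congr_deriv ?_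
  simp [coeff₁]

theorem IsGlobalProfile.hasDerivAt_coeff₁ (h : IsGlobalProfile R a f f₁ f₂) (t : ℝ) :
    HasDerivAt (coeff₁ f f₁) (coeff₂ f f₁ f₂ t) t := by
  refine (((h.hasDerivAt' t).const_mul 2).add (((h.hasDerivAt t).pow 2).add
    ((hasDerivAt_id t).mul (((h.hasDerivAt t).const_mul 2).mul (h.hasDerivAt' t))))).congr_deriv ?_
  simp [coeff₂]

theorem IsGlobalProfile.pos_nsq (h : IsGlobalProfile R a f f₁ f₂) {x : Plane} (hx : x ∈ disk R) :
    0 < 1 + nsq x * f (nsq x) :=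
  h.pos _ ⟨nsq_nonneg x, (mem_disk_iff h.radius_pos.le x).1 hx⟩

theorem IsGlobalProfile.eq_norm (h : IsGlobalProfile R a f f₁ f₂) {x : Plane} (hx : x ∈ disk R) :
    a ‖x‖ = 1 + nsq x * f (nsq x) := by
  rw [h.eq _ ⟨norm_nonneg x, mem_closedBall_zero_iff.1 hx⟩, norm_sq_eq_nsq]

theorem IsGlobalProfile.metric_eq (h : IsGlobalProfile R a f f₁ f₂) {x : Plane}
    (hx : x ∈ disk R) : metric a x = radialMetric (coeff f) x := by
  ext i j
  simp only [metric, radialMetric, Matrix.of_apply, h.eq_norm hx, norm_sq_eq_nsq]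
  -- At the origin the quotient `(a² - 1) / ‖x‖²` is a division by zero, but its factor `x i * x j`
  -- vanishes there.
  by_cases h0 : nsq x = 0
  · have : x = 0 := by
      rw [← norm_sq_eq_nsq] at h0
      simpa using h0
    simp [this]
  · congr 2
    rw [coeff]
    field_simp
    ring

theorem IsGlobalProfile.pd_metric (h : IsGlobalProfile R a f f₁ f₂) {x : Plane}
    (hx : x ∈ disk R) (k i j : Fin 2) :
    pd (disk R) k (fun y => metric a y i j) x =
      2 * coeff₁ f f₁ (nsq x) * x k * (x i * x j) + coeff f (nsq x) *
        ((if k = i then 1 else 0) * x j + x i * (if k = j then 1 else 0)) := by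
  rw [pd_of_hasFDerivAt h.radius_pos hx
    (g := fun y => (if i = j then 1 else 0) + coeff f (nsq y) * (y i * y j))
    (fun y hy => by simp only [h.metric_eq hy, radialMetric, Matrix.of_apply])
    (((hasFDerivAt_comp_nsq (h.hasDerivAt_coeff _)).mul
      ((hasFDerivAt_coord i x).mul (hasFDerivAt_coord j x))).const_add _)]
  fin_cases k <;> fin_cases i <;> fin_cases j <;> simp <;> ring

/-- With the upper index lowered, the symbol is `x_m` times a scalar, and `x` is an eigenvector of
the metric matrix with eigenvalue `1 + t F(t)`. So the symbols with fixed lower indices form a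
radial vector. -/
theorem IsGlobalProfile.christoffel_eq (h : IsGlobalProfile R a f f₁ f₂) {x : Plane}
    (hx : x ∈ disk R) (l i j : Fin 2) :
    christoffel (disk R) (metric a) l i j x =
      (1 + nsq x * coeff f (nsq x))⁻¹ * (x l * (coeff₁ f f₁ (nsq x) * (x i * x j)
        + coeff f (nsq x) * (if i = j then 1 else 0))) := by
  have hd : 1 + nsq x * coeff f (nsq x) ≠ 0 := by
    rw [one_add_mul_coeff]; exact (pow_pos (h.pos_nsq hx) 2).ne'
  simp only [christoffel, h.pd_metric hx, Fin.sum_univ_two]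
  rw [h.metric_eq hx, Matrix.inv_def, Matrix.adjugate_fin_two, det_radialMetric,
    Ring.inverse_eq_inv']
  set F := coeff f (nsq x)
  set F₁ := coeff₁ f f₁ (nsq x)
  fin_cases l <;> fin_cases i <;> fin_cases j <;> simp [radialMetric] <;> field_simp <;>
    simp only [nsq] <;> ring

/-- This is the classical `K = a'(r) / (r a³)` written in the variable `t = r²`. The second
derivative `f₂` enters the derivatives of the Christoffel symbols and cancels. -/
theorem IsGlobalProfile.gaussCurvature_eq (h : IsGlobalProfile R a f f₁ f₂) {x : Plane}
    (hx : x ∈ disk R) :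
    gaussCurvature (disk R) (metric a) x =
      2 * (f (nsq x) + nsq x * f₁ (nsq x)) / (1 + nsq x * f (nsq x)) ^ 3 := by
  have hp := h.pos_nsq hx
  have hd : 1 + nsq x * coeff f (nsq x) ≠ 0 := by
    rw [one_add_mul_coeff]; exact (pow_pos hp 2).ne'
  have hpd : ∀ k l i j : Fin 2, pd (disk R) k (christoffel (disk R) (metric a) l i j) x =
      (1 + nsq x * coeff f (nsq x))⁻¹ * ((if k = l then 1 else 0) * (coeff₁ f f₁ (nsq x)
          * (x i * x j) + coeff f (nsq x) * (if i = j then 1 else 0))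
        + x l * (coeff₂ f f₁ f₂ (nsq x) * (2 * x k) * (x i * x j)
          + coeff₁ f f₁ (nsq x) * ((if k = i then 1 else 0) * x j + x i * if k = j then 1 else 0)
          + coeff₁ f f₁ (nsq x) * (2 * x k) * (if i = j then 1 else 0)))
      - (1 + nsq x * coeff f (nsq x))⁻¹ ^ 2 * (coeff f (nsq x) + nsq x * coeff₁ f f₁ (nsq x))
        * (2 * x k) * (x l * (coeff₁ f f₁ (nsq x) * (x i * x j)
          + coeff f (nsq x) * (if i = j then 1 else 0))) := fun k l i j => by
    rw [pd_of_hasFDerivAt h.radius_pos hx (fun y hy => h.christoffel_eq hy l i j)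
      ((hasFDerivAt_comp_nsq
        ((((hasDerivAt_id _).mul (h.hasDerivAt_coeff _)).const_add 1).inv hd)).mul
        ((hasFDerivAt_coord l x).mul (((hasFDerivAt_comp_nsq (h.hasDerivAt_coeff₁ _)).mul
          ((hasFDerivAt_coord i x).mul (hasFDerivAt_coord j x))).add
          ((hasFDerivAt_comp_nsq (h.hasDerivAt_coeff _)).mul_const (if i = j then 1 else 0))))) k]
    generalize (if i = j then (1 : ℝ) else 0) = d
    fin_cases k <;> fin_cases l <;> fin_cases i <;> fin_cases j <;> simp <;> ring
  simp only [gaussCurvature, riemann, hpd, h.christoffel_eq hx, Fin.sum_univ_two]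
  rw [h.metric_eq hx, det_radialMetric]
  have key : 2 * (f (nsq x) + nsq x * f₁ (nsq x)) / (1 + nsq x * f (nsq x)) ^ 3 =
      (coeff f (nsq x) + nsq x * coeff₁ f f₁ (nsq x)) / (1 + nsq x * coeff f (nsq x)) ^ 2 := by
    rw [one_add_mul_coeff, div_eq_div_iff (by positivity) (by positivity), coeff, coeff₁]
    ring
  rw [key]
  simp [radialMetric]
  generalize coeff f (nsq x) = F at *
  generalize coeff₁ f f₁ (nsq x) = F₁ at *
  generalize coeff₂ f f₁ f₂ (nsq x) = F₂ at *
  obtain ⟨e, he⟩ : ∃ e, e = 1 + nsq x * F := ⟨_, rfl⟩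
  rw [← he] at hd ⊢
  field_simp
  rw [he, nsq]
  ring

end

/-! ### Geodesics in Cartesian coordinates -/

/-- The Euclidean inner product, as a polynomial in the coordinates. -/
def dot (x v : Plane) : ℝ := x 0 * v 0 + x 1 * v 1

theorem hasDerivWithinAt_plane_iff {γ : ℝ → Plane} {v : Plane} {I : Set ℝ} {t : ℝ} :
    HasDerivWithinAt γ v I t ↔ HasDerivWithinAt (fun τ => γ τ 0) (v 0) I t ∧
      HasDerivWithinAt (fun τ => γ τ 1) (v 1) I t := by
  have h : ∀ i : Fin 2, (PiLp.proj 2 (fun _ => ℝ) i ∘L ContinuousLinearMap.toSpanSingleton ℝ v)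
      = ContinuousLinearMap.toSpanSingleton ℝ (v i) := fun i => by ext; simp
  rw [hasDerivWithinAt_iff_hasFDerivWithinAt, hasFDerivWithinAt_euclidean, Fin.forall_fin_two,
    h, h]
  rfl

theorem eq_of_hasDerivWithinAt_zero {g : ℝ → ℝ} {I : Set ℝ} (hI : Convex ℝ I)
    (h : ∀ t ∈ I, HasDerivWithinAt g 0 I t) {x y : ℝ} (hx : x ∈ I) (hy : y ∈ I) : g x = g y := by
  have := hI.norm_image_sub_le_of_norm_hasDerivWithin_le (C := 0) h (by simp) hy hx
  simpa [sub_eq_zero] using this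

/-- The Euclidean scalar by which the Christoffel symbols act: `Γ_x(v, v) = sprayCoeff • x`. -/
def sprayCoeff (f f₁ : ℝ → ℝ) (x v : Plane) : ℝ :=
  (coeff₁ f f₁ (nsq x) * dot x v ^ 2 + coeff f (nsq x) * nsq v) / (1 + nsq x * f (nsq x)) ^ 2

/-- Along a geodesic, a primitive of `1 / a`; it is the arc length parameter of the Euclidean line
which the geodesic is a twist of. -/
def abscissa (f : ℝ → ℝ) (x v : Plane) : ℝ := (1 + nsq x * f (nsq x)) * dot x v

/-- The angular momentum, preserved along geodesics. -/
def momentum (x v : Plane) : ℝ := x 0 * v 1 - x 1 * v 0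

/-- The first component of the twisting rotation. -/
def twist₀ (f : ℝ → ℝ) (x v : Plane) : ℝ :=
  (1 + nsq x * f (nsq x)) * v 0 + momentum x v * f (nsq x) * x 1

/-- The second component of the twisting rotation. -/
def twist₁ (f : ℝ → ℝ) (x v : Plane) : ℝ :=
  (1 + nsq x * f (nsq x)) * v 1 - momentum x v * f (nsq x) * x 0

section

variable {R : ℝ} {a f f₁ f₂ : ℝ → ℝ}

theorem IsGlobalProfile.inn_metric (h : IsGlobalProfile R a f f₁ f₂) {x : Plane}
    (hx : x ∈ disk R) (v w : Plane) :
    inn (metric a) x v w = dot v w + coeff f (nsq x) * (dot x v * dot x w) := by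
  simp [inn, h.metric_eq hx, radialMetric, Fin.sum_univ_two, dot]
  ring

theorem IsGlobalProfile.christoffelVec_apply (h : IsGlobalProfile R a f f₁ f₂) {x : Plane}
    (hx : x ∈ disk R) (v w : Plane) (l : Fin 2) :
    christoffelVec (disk R) (metric a) x v w l =
      (coeff₁ f f₁ (nsq x) * (dot x v * dot x w) + coeff f (nsq x) * dot v w)
        / (1 + nsq x * f (nsq x)) ^ 2 * x l := by
  simp [christoffelVec, h.christoffel_eq hx, Fin.sum_univ_two, dot, one_add_mul_coeff]
  ring

theorem IsGlobalProfile.isGeodesicOn_iff (h : IsGlobalProfile R a f f₁ f₂) {γ w : ℝ → Plane}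
    {I : Set ℝ} :
    IsGeodesicOn (disk R) (metric a) γ w I ↔ ∀ t ∈ I, nsq (γ t) ≤ R ^ 2 ∧
      nsq (w t) + coeff f (nsq (γ t)) * dot (γ t) (w t) ^ 2 = 1 ∧
      (HasDerivWithinAt (fun τ => γ τ 0) (w t 0) I t ∧
        HasDerivWithinAt (fun τ => γ τ 1) (w t 1) I t) ∧
      (HasDerivWithinAt (fun τ => w τ 0) (-(sprayCoeff f f₁ (γ t) (w t) * γ t 0)) I t ∧
        HasDerivWithinAt (fun τ => w τ 1) (-(sprayCoeff f f₁ (γ t) (w t) * γ t 1)) I t) := by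
  refine forall₂_congr fun t _ => ?_
  rw [unitTangent, mem_ofPred_eq, and_assoc]
  refine (and_congr_left' (mem_disk_iff h.radius_pos.le _)).trans (and_congr_right fun hx => ?_)
  have hx' := (mem_disk_iff h.radius_pos.le _).2 hx
  rw [hasDerivWithinAt_plane_iff, hasDerivWithinAt_plane_iff, h.inn_metric hx']
  simp only [PiLp.neg_apply, h.christoffelVec_apply hx', sprayCoeff, dot, nsq, pow_two]

/-- Unit speed turns this into Lagrange's identity `⟨x, v⟩² + L² = |x|² |v|²`, because `a² = 1 + t
F(t)`. -/
theorem abscissa_sq_add (f : ℝ → ℝ) {x v : Plane}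
    (hv : nsq v + coeff f (nsq x) * dot x v ^ 2 = 1) :
    abscissa f x v ^ 2 + momentum x v ^ 2 = nsq x := by
  have : nsq x = nsq x * (nsq v + coeff f (nsq x) * dot x v ^ 2) := by rw [hv, mul_one]
  conv_rhs => rw [this]
  rw [abscissa, mul_pow, ← one_add_mul_coeff, momentum, dot]
  generalize coeff f (nsq x) = F
  simp only [nsq]
  ring

/-- Real part of `x = u (s - iL)`, where `u = a v - i L f x` has components `twist₀` and `twist₁`;
`apply_one_eq` is the imaginary part. -/
theorem apply_zero_eq (f : ℝ → ℝ) {x v : Plane}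
    (hv : nsq v + coeff f (nsq x) * dot x v ^ 2 = 1) :
    x 0 = twist₀ f x v * abscissa f x v + twist₁ f x v * momentum x v := by
  have := congr_arg (x 0 * ·) hv
  simp only [mul_one] at this
  rw [← this]
  simp only [twist₀, twist₁, abscissa, coeff, momentum, dot]
  generalize f (nsq x) = F
  simp only [nsq]
  ring

theorem apply_one_eq (f : ℝ → ℝ) {x v : Plane}
    (hv : nsq v + coeff f (nsq x) * dot x v ^ 2 = 1) :
    x 1 = twist₁ f x v * abscissa f x v - twist₀ f x v * momentum x v := by
  have := congr_arg (x 1 * ·) hv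
  simp only [mul_one] at this
  rw [← this]
  simp only [twist₀, twist₁, abscissa, coeff, momentum, dot]
  generalize f (nsq x) = F
  simp only [nsq]
  ring

/-! ### Evolution of these quantities along a geodesic -/

section Along

variable {γ w : ℝ → Plane} {I : Set ℝ} {t : ℝ}

theorem IsGlobalProfile.hasDerivWithinAt_nsq (h : IsGlobalProfile R a f f₁ f₂)
    (hγ : IsGeodesicOn (disk R) (metric a) γ w I) (ht : t ∈ I) :
    HasDerivWithinAt (fun τ => nsq (γ τ)) (2 * dot (γ t) (w t)) I t := by
  obtain ⟨-, -, ⟨h0, h1⟩, -⟩ := h.isGeodesicOn_iff.1 hγ t ht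
  refine ((h0.pow 2).add (h1.pow 2)).congr_deriv ?_
  simp [dot]
  ring

theorem IsGlobalProfile.hasDerivWithinAt_profile (h : IsGlobalProfile R a f f₁ f₂)
    (hγ : IsGeodesicOn (disk R) (metric a) γ w I) (ht : t ∈ I) :
    HasDerivWithinAt (fun τ => f (nsq (γ τ))) (f₁ (nsq (γ t)) * (2 * dot (γ t) (w t))) I t :=
  (h.hasDerivAt _).comp_hasDerivWithinAt t (h.hasDerivWithinAt_nsq hγ ht)

theorem IsGlobalProfile.hasDerivWithinAt_factor (h : IsGlobalProfile R a f f₁ f₂)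
    (hγ : IsGeodesicOn (disk R) (metric a) γ w I) (ht : t ∈ I) :
    HasDerivWithinAt (fun τ => 1 + nsq (γ τ) * f (nsq (γ τ)))
      (2 * dot (γ t) (w t) * (f (nsq (γ t)) + nsq (γ t) * f₁ (nsq (γ t)))) I t :=
  (((h.hasDerivWithinAt_nsq hγ ht).mul (h.hasDerivWithinAt_profile hγ ht)).const_add 1).congr_deriv
    (by ring)

/-- The acceleration is a multiple of the position vector, as for a central force. -/
theorem IsGlobalProfile.hasDerivWithinAt_momentum (h : IsGlobalProfile R a f f₁ f₂)
    (hγ : IsGeodesicOn (disk R) (metric a) γ w I) (ht : t ∈ I) :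
    HasDerivWithinAt (fun τ => momentum (γ τ) (w τ)) 0 I t := by
  obtain ⟨-, -, ⟨h0, h1⟩, h2, h3⟩ := h.isGeodesicOn_iff.1 hγ t ht
  exact ((h0.mul h3).sub (h1.mul h2)).congr_deriv (by ring)

theorem IsGlobalProfile.momentum_eq (h : IsGlobalProfile R a f f₁ f₂)
    (hγ : IsGeodesicOn (disk R) (metric a) γ w I) (hI : Convex ℝ I) {t₀ : ℝ} (ht₀ : t₀ ∈ I)
    (ht : t ∈ I) : momentum (γ t) (w t) = momentum (γ t₀) (w t₀) :=
  eq_of_hasDerivWithinAt_zero hI (fun _ hs => h.hasDerivWithinAt_momentum hγ hs) ht ht₀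

theorem IsGlobalProfile.factor_pos (h : IsGlobalProfile R a f f₁ f₂)
    (hγ : IsGeodesicOn (disk R) (metric a) γ w I) (ht : t ∈ I) :
    0 < 1 + nsq (γ t) * f (nsq (γ t)) :=
  h.pos_nsq (hγ t ht).1.1

theorem IsGlobalProfile.abscissa_sq_add_sq (h : IsGlobalProfile R a f f₁ f₂)
    (hγ : IsGeodesicOn (disk R) (metric a) γ w I) (hI : Convex ℝ I) {t₀ : ℝ} (ht₀ : t₀ ∈ I)
    (ht : t ∈ I) :
    momentum (γ t₀) (w t₀) ^ 2 + abscissa f (γ t) (w t) ^ 2 = nsq (γ t) := by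
  rw [← abscissa_sq_add f (h.isGeodesicOn_iff.1 hγ t ht).2.1, h.momentum_eq hγ hI ht₀ ht, add_comm]

theorem IsGlobalProfile.hasDerivWithinAt_abscissa (h : IsGlobalProfile R a f f₁ f₂)
    (hγ : IsGeodesicOn (disk R) (metric a) γ w I) (ht : t ∈ I) :
    HasDerivWithinAt (fun τ => abscissa f (γ τ) (w τ)) (1 + nsq (γ t) * f (nsq (γ t)))⁻¹ I t := by
  obtain ⟨-, hu, ⟨h0, h1⟩, h2, h3⟩ := h.isGeodesicOn_iff.1 hγ t ht
  have hp := h.factor_pos hγ ht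
  refine ((h.hasDerivWithinAt_factor hγ ht).mul ((h0.mul h2).add (h1.mul h3))).congr_deriv ?_
  rw [← one_div, eq_div_iff hp.ne']
  refine Eq.trans ?_ hu
  simp only [sprayCoeff, dot, coeff, coeff₁, Pi.mul_apply, Pi.add_apply]
  obtain ⟨e, he⟩ : ∃ e, e = 1 + nsq (γ t) * f (nsq (γ t)) := ⟨_, rfl⟩
  rw [← he] at hp ⊢
  field_simp
  rw [he]
  generalize f (nsq (γ t)) = F
  generalize f₁ (nsq (γ t)) = F₁
  simp only [nsq]
  ring

/-- Real part of `du/dt = i (L f / a) u`; the imaginary part is `hasDerivWithinAt_twist₁`. -/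
theorem IsGlobalProfile.hasDerivWithinAt_twist₀ (h : IsGlobalProfile R a f f₁ f₂)
    (hγ : IsGeodesicOn (disk R) (metric a) γ w I) (ht : t ∈ I) :
    HasDerivWithinAt (fun τ => twist₀ f (γ τ) (w τ))
      (-(momentum (γ t) (w t) * f (nsq (γ t)) * (1 + nsq (γ t) * f (nsq (γ t)))⁻¹
        * twist₁ f (γ t) (w t))) I t := by
  obtain ⟨-, hu, ⟨h0, h1⟩, h2, h3⟩ := h.isGeodesicOn_iff.1 hγ t ht
  have hp := h.factor_pos hγ ht
  refine (((h.hasDerivWithinAt_factor hγ ht).mul h2).add (((h.hasDerivWithinAt_momentum hγ ht).mul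
    (h.hasDerivWithinAt_profile hγ ht)).mul h1)).congr_deriv ?_
  simp only [twist₁, sprayCoeff, momentum, dot, coeff, coeff₁, Pi.mul_apply]
  obtain ⟨e, he⟩ : ∃ e, e = 1 + nsq (γ t) * f (nsq (γ t)) := ⟨_, rfl⟩
  rw [← he] at hp ⊢
  field_simp
  rw [he]
  generalize f (nsq (γ t)) = F
  generalize f₁ (nsq (γ t)) = F₁
  simp only [nsq]
  ring

theorem IsGlobalProfile.hasDerivWithinAt_twist₁ (h : IsGlobalProfile R a f f₁ f₂)
    (hγ : IsGeodesicOn (disk R) (metric a) γ w I) (ht : t ∈ I) :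
    HasDerivWithinAt (fun τ => twist₁ f (γ τ) (w τ))
      (momentum (γ t) (w t) * f (nsq (γ t)) * (1 + nsq (γ t) * f (nsq (γ t)))⁻¹
        * twist₀ f (γ t) (w t)) I t := by
  obtain ⟨-, hu, ⟨h0, h1⟩, h2, h3⟩ := h.isGeodesicOn_iff.1 hγ t ht
  have hp := h.factor_pos hγ ht
  refine (((h.hasDerivWithinAt_factor hγ ht).mul h3).sub (((h.hasDerivWithinAt_momentum hγ ht).mul
    (h.hasDerivWithinAt_profile hγ ht)).mul h0)).congr_deriv ?_
  simp only [twist₀, sprayCoeff, momentum, dot, coeff, coeff₁, Pi.mul_apply]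
  obtain ⟨e, he⟩ : ∃ e, e = 1 + nsq (γ t) * f (nsq (γ t)) := ⟨_, rfl⟩
  rw [← he] at hp ⊢
  field_simp
  rw [he]
  generalize f (nsq (γ t)) = F
  generalize f₁ (nsq (γ t)) = F₁
  simp only [nsq]
  ring

end Along

/-! ### Strict convexity of the boundary -/

/-- On vectors tangent to the boundary the normal field differentiates as multiplication by `-(a(R)
R)⁻¹`, and the Christoffel term is radial, hence orthogonal to `v`. The second fundamental form is
thus `|v|² / (a(R) R)`, positive without further hypothesis. -/
theorem IsGlobalProfile.isStrictlyConvex (h : IsGlobalProfile R a f f₁ f₂) :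
    IsStrictlyConvex (disk R) (metric a) (normal a) := by
  intro x hx v hv hvx
  have hR := h.radius_pos
  have hxn : ‖x‖ = R := by
    rw [disk, frontier_closedBall _ hR.ne'] at hx
    simpa using hx
  have hxd : x ∈ disk R := by simp [hxn]
  have hnsq : nsq x = R ^ 2 := by rw [← norm_sq_eq_nsq, hxn]
  have hx0 : x ≠ 0 := by rintro rfl; simp at hxn; exact hR.ne hxn
  have hp := h.pos_nsq hxd
  have hn : ∀ y, normal a y = (-(a ‖y‖ * ‖y‖)⁻¹) • y := fun y => by rw [normal, er, neg_smul]
  have hvdot : dot x v = 0 := by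
    rw [h.inn_metric hxd, hn] at hvx
    have : (a ‖x‖ * ‖x‖)⁻¹ * (1 + nsq x * f (nsq x)) ^ 2 * dot x v = 0 := by
      rw [← one_add_mul_coeff, ← neg_eq_zero, ← hvx]
      simp [dot, nsq]
      ring
    have ha : a ‖x‖ ≠ 0 := by rw [h.eq_norm hxd]; exact hp.ne'
    simpa [ha, hx0, hp.ne'] using this
  -- The value of `d` is immaterial: in the direction `v` it is multiplied by `2 * dot x v = 0`.
  obtain ⟨d, hd⟩ : ∃ d, HasDerivAt (fun t : ℝ => -((1 + t * f t) * √t)⁻¹) d (nsq x) := by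
    have hpos : 0 < nsq x := by rw [hnsq]; positivity
    have h1 := (h.hasDerivAt (nsq x)).differentiableAt
    have h2 : (1 + nsq x * f (nsq x)) * √(nsq x) ≠ 0 := by positivity
    exact ⟨_, DifferentiableAt.hasDerivAt (by fun_prop (disch := first | assumption | exact hpos.ne'))⟩
  have hfd := (hasFDerivAt_comp_nsq hd).smul (hasFDerivAt_id x)
  have hcongr : ∀ y ∈ disk R, normal a y = -((1 + nsq y * f (nsq y)) * √(nsq y))⁻¹ • id y :=
    fun y hy => by
      rw [hn, h.eq_norm hy, ← norm_sq_eq_nsq, sqrt_sq (norm_nonneg _), id]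
  have hDv : fderivWithin ℝ (normal a) (disk R) x v =
      (-((1 + nsq x * f (nsq x)) * √(nsq x))⁻¹) • v := by
    rw [(hfd.hasFDerivWithinAt.congr hcongr (hcongr x hxd)).fderivWithin
      (uniqueDiffOn_disk hR x hxd)]
    have : 2 * x 0 * v 0 + 2 * x 1 * v 1 = 0 := by rw [dot] at hvdot; linarith
    simp only [add_apply, smul_apply, ContinuousLinearMap.smulRight_apply, PiLp.proj_apply,
      ContinuousLinearMap.id_apply, smul_eq_mul, this]
    simp
  have hc : 0 < ((1 + nsq x * f (nsq x)) * √(nsq x))⁻¹ := by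
    rw [hnsq, sqrt_sq hR.le, ← hnsq]; positivity
  have hv2 : 0 < nsq v := by rw [← norm_sq_eq_nsq]; positivity
  rw [hDv, h.inn_metric hxd, hvdot, mul_zero, mul_zero, add_zero]
  generalize ((1 + nsq x * f (nsq x)) * √(nsq x))⁻¹ = c at hc ⊢
  have : ∀ q : ℝ, (-c * v 0 + q * x 0) * v 0 + (-c * v 1 + q * x 1) * v 1
      = -(c * nsq v) + q * dot x v := fun q => by rw [nsq, dot]; ring
  simp only [dot, PiLp.add_apply, PiLp.smul_apply, smul_eq_mul, h.christoffelVec_apply hxd] at this ⊢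
  rw [this, ← dot, hvdot, mul_zero, add_zero, neg_neg]
  positivity

end

/-! ### Travel time and phase along a geodesic -/

/-- The function `1 + t f(t)` on `[0, R²]`, extended by constants. -/
def extFactor (R : ℝ) (f : ℝ → ℝ) (t : ℝ) : ℝ :=
  IccExtend (sq_nonneg R) ((Icc 0 (R ^ 2)).domRestrict fun t => 1 + t * f t) t

/-- The time in which the geodesics of angular momentum `L` pass from abscissa `0` to `s`. -/
def travel (R : ℝ) (f : ℝ → ℝ) (L s : ℝ) : ℝ := ∫ σ in 0..s, extFactor R f (L ^ 2 + σ ^ 2)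

/-- The angle by which the geodesics of angular momentum `L` are twisted at abscissa `s`. -/
def phase (f : ℝ → ℝ) (L s : ℝ) : ℝ := L * ∫ σ in 0..s, f (L ^ 2 + σ ^ 2)

/-- The derivative of `phase f L s` with respect to `L`. -/
def phaseVar (f f₁ : ℝ → ℝ) (L s : ℝ) : ℝ :=
  ∫ σ in 0..s, (f (L ^ 2 + σ ^ 2) + 2 * L ^ 2 * f₁ (L ^ 2 + σ ^ 2))

/-- The normal component of the variation of the geodesics in `L`, as a function of the abscissa. -/
def jacobi (f f₁ : ℝ → ℝ) (L s : ℝ) : ℝ :=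
  -1 - L ^ 2 * f (L ^ 2 + s ^ 2) + s * phaseVar f f₁ L s

theorem hasDerivAt_integral_of_continuous {g : ℝ → ℝ} (hg : Continuous g) (s : ℝ) :
    HasDerivAt (fun s => ∫ σ in 0..s, g σ) (g s) s :=
  intervalIntegral.integral_hasDerivAt_right (hg.intervalIntegrable _ _)
    (hg.stronglyMeasurableAtFilter _ _) hg.continuousAt

theorem integral_neg_of_even {g : ℝ → ℝ} (hg : ∀ x, g (-x) = g x) (s : ℝ) :
    ∫ σ in 0..(-s), g σ = -∫ σ in 0..s, g σ := by
  have := intervalIntegral.integral_comp_neg (a := 0) (b := s) g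
  simp only [hg, neg_zero] at this
  rw [this, intervalIntegral.integral_symm]

section

variable {R : ℝ} {a f f₁ f₂ : ℝ → ℝ}

theorem IsGlobalProfile.continuous (h : IsGlobalProfile R a f f₁ f₂) : Continuous f :=
  continuous_iff_continuousAt.2 fun t => (h.hasDerivAt t).continuousAt

theorem IsGlobalProfile.continuous' (h : IsGlobalProfile R a f f₁ f₂) : Continuous f₁ :=
  continuous_iff_continuousAt.2 fun t => (h.hasDerivAt' t).continuousAt

theorem IsGlobalProfile.continuous_extFactor (h : IsGlobalProfile R a f f₁ f₂) :
    Continuous (extFactor R f) := by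
  have := h.continuous
  have hc : Continuous fun t => 1 + t * f t := by fun_prop
  exact (hc.continuousOn.domRestrict (s := Icc 0 (R ^ 2))).Icc_extend' (h := sq_nonneg R)

theorem extFactor_of_mem {t : ℝ} (ht : t ∈ Icc 0 (R ^ 2)) : extFactor R f t = 1 + t * f t := by
  rw [extFactor, IccExtend_of_mem _ _ ht]; rfl

theorem IsGlobalProfile.exists_le_extFactor (h : IsGlobalProfile R a f f₁ f₂) :
    ∃ m, 0 < m ∧ ∀ t, m ≤ extFactor R f t := by
  have := h.continuous
  have hc : Continuous fun t => 1 + t * f t := by fun_prop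
  obtain ⟨t₀, ht₀, hmin⟩ := isCompact_Icc.exists_isMinOn
    (nonempty_Icc.2 (sq_nonneg R)) hc.continuousOn
  exact ⟨_, h.pos t₀ ht₀, fun t => hmin (projIcc 0 (R ^ 2) (sq_nonneg R) t).2⟩

theorem IsGlobalProfile.exists_extFactor_le (h : IsGlobalProfile R a f f₁ f₂) :
    ∃ m, ∀ t, extFactor R f t ≤ m := by
  have := h.continuous
  have hc : Continuous fun t => 1 + t * f t := by fun_prop
  obtain ⟨t₀, -, hmax⟩ := isCompact_Icc.exists_isMaxOn
    (nonempty_Icc.2 (sq_nonneg R)) hc.continuousOn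
  exact ⟨_, fun t => hmax (projIcc 0 (R ^ 2) (sq_nonneg R) t).2⟩

theorem IsGlobalProfile.extFactor_pos (h : IsGlobalProfile R a f f₁ f₂) (t : ℝ) :
    0 < extFactor R f t :=
  let ⟨_, hm, hle⟩ := h.exists_le_extFactor; hm.trans_le (hle t)

theorem IsGlobalProfile.hasDerivAt_travel (h : IsGlobalProfile R a f f₁ f₂) (L s : ℝ) :
    HasDerivAt (travel R f L) (extFactor R f (L ^ 2 + s ^ 2)) s :=
  hasDerivAt_integral_of_continuous (h.continuous_extFactor.comp (by fun_prop)) s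

theorem IsGlobalProfile.hasDerivAt_phase (h : IsGlobalProfile R a f f₁ f₂) (L s : ℝ) :
    HasDerivAt (phase f L) (L * f (L ^ 2 + s ^ 2)) s :=
  (hasDerivAt_integral_of_continuous (h.continuous.comp (by fun_prop)) s).const_mul L

theorem IsGlobalProfile.hasDerivAt_phaseVar (h : IsGlobalProfile R a f f₁ f₂) (L s : ℝ) :
    HasDerivAt (phaseVar f f₁ L) (f (L ^ 2 + s ^ 2) + 2 * L ^ 2 * f₁ (L ^ 2 + s ^ 2)) s := by
  have h1 := h.continuous
  have h2 := h.continuous'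
  exact hasDerivAt_integral_of_continuous
    (g := fun s => f (L ^ 2 + s ^ 2) + 2 * L ^ 2 * f₁ (L ^ 2 + s ^ 2)) (by fun_prop) s

theorem hasDerivAt_comp_sq {g : ℝ → ℝ} {g' L s : ℝ} (hg : HasDerivAt g g' (L ^ 2 + s ^ 2)) :
    HasDerivAt (fun s => g (L ^ 2 + s ^ 2)) (g' * (2 * s)) s := by
  refine hg.comp s (((hasDerivAt_pow 2 s).const_add (L ^ 2)).congr_deriv ?_)
  simp

theorem IsGlobalProfile.hasDerivAt_jacobi (h : IsGlobalProfile R a f f₁ f₂) (L s : ℝ) :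
    HasDerivAt (jacobi f f₁ L) (phaseVar f f₁ L s + s * f (L ^ 2 + s ^ 2)) s := by
  refine ((((hasDerivAt_comp_sq (h.hasDerivAt _)).const_mul (L ^ 2)).const_sub (-1)).add
    ((hasDerivAt_id s).mul (h.hasDerivAt_phaseVar L s))).congr_deriv ?_
  simp only [id]
  ring

@[simp] theorem travel_zero (R : ℝ) (f : ℝ → ℝ) (L : ℝ) : travel R f L 0 = 0 := by simp [travel]

theorem travel_neg (R : ℝ) (f : ℝ → ℝ) (L s : ℝ) : travel R f L (-s) = -travel R f L s :=
  integral_neg_of_even (fun x => by rw [neg_sq]) s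

theorem travel_neg_left (R : ℝ) (f : ℝ → ℝ) (L s : ℝ) : travel R f (-L) s = travel R f L s := by
  simp only [travel, neg_sq]

theorem phase_neg (f : ℝ → ℝ) (L s : ℝ) : phase f L (-s) = -phase f L s := by
  rw [phase, integral_neg_of_even (fun x => by rw [neg_sq]) s, phase, mul_neg]

theorem phaseVar_neg (f f₁ : ℝ → ℝ) (L s : ℝ) : phaseVar f f₁ L (-s) = -phaseVar f f₁ L s :=
  integral_neg_of_even (fun x => by rw [neg_sq]) s

theorem jacobi_neg (f f₁ : ℝ → ℝ) (L s : ℝ) : jacobi f f₁ L (-s) = jacobi f f₁ L s := by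
  rw [jacobi, jacobi, phaseVar_neg, neg_sq, neg_mul_neg]

theorem IsGlobalProfile.strictMono_travel (h : IsGlobalProfile R a f f₁ f₂) (L : ℝ) :
    StrictMono (travel R f L) :=
  strictMono_of_deriv_pos fun s => by
    rw [(h.hasDerivAt_travel L s).deriv]; exact h.extFactor_pos _

theorem IsGlobalProfile.continuous_travel (h : IsGlobalProfile R a f f₁ f₂) (L : ℝ) :
    Continuous (travel R f L) :=
  continuous_iff_continuousAt.2 fun s => (h.hasDerivAt_travel L s).continuousAt

/-- Extending the factor by constants outside `[0, R²]` keeps it above a positive constant, so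
travel time is unbounded in both directions and has an inverse on the whole line. -/
theorem IsGlobalProfile.surjective_travel (h : IsGlobalProfile R a f f₁ f₂) (L : ℝ) :
    Function.Surjective (travel R f L) := by
  obtain ⟨m, hm, hle⟩ := h.exists_le_extFactor
  have hs : ∀ s, 0 ≤ s → m * s ≤ travel R f L s := fun s hs => by
    have := intervalIntegral.integral_mono_on (μ := MeasureTheory.volume) (f := fun _ => m)
      (g := fun σ => extFactor R f (L ^ 2 + σ ^ 2)) hs (by simp)
      ((h.continuous_extFactor.comp (by fun_prop)).intervalIntegrable _ _) fun _ _ => hle _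
    rw [intervalIntegral.integral_const, sub_zero, smul_eq_mul, mul_comm] at this
    exact this
  intro y
  have hy := hs (|y| / m) (by positivity)
  rw [mul_div_cancel₀ _ hm.ne'] at hy
  refine mem_range_of_exists_le_of_exists_ge (h.continuous_travel L) ⟨-(|y| / m), ?_⟩
    ⟨|y| / m, (le_abs_self y).trans hy⟩
  rw [travel_neg]
  linarith [neg_abs_le y]

/-- The abscissa at time `t` on the geodesics of angular momentum `L`. -/
def IsGlobalProfile.position (h : IsGlobalProfile R a f f₁ f₂) (L : ℝ) : ℝ ≃o ℝ :=
  ((h.strictMono_travel L).orderIsoOfSurjective _ (h.surjective_travel L)).symm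

@[simp] theorem IsGlobalProfile.position_travel (h : IsGlobalProfile R a f f₁ f₂) (L s : ℝ) :
    h.position L (travel R f L s) = s :=
  ((h.strictMono_travel L).orderIsoOfSurjective _ (h.surjective_travel L)).symm_apply_apply s

@[simp] theorem IsGlobalProfile.travel_position (h : IsGlobalProfile R a f f₁ f₂) (L t : ℝ) :
    travel R f L (h.position L t) = t :=
  ((h.strictMono_travel L).orderIsoOfSurjective _ (h.surjective_travel L)).apply_symm_apply t

theorem IsGlobalProfile.hasDerivAt_position (h : IsGlobalProfile R a f f₁ f₂) (L t : ℝ) :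
    HasDerivAt (h.position L) (extFactor R f (L ^ 2 + h.position L t ^ 2))⁻¹ t :=
  (h.hasDerivAt_travel L _).of_local_left_inverse (h.position L).continuous.continuousAt
    (h.extFactor_pos _).ne' (Filter.Eventually.of_forall fun t => h.travel_position L t)

theorem IsGlobalProfile.position_sq_le (h : IsGlobalProfile R a f f₁ f₂) {L s t : ℝ}
    (ht : t ∈ uIcc (-travel R f L s) (travel R f L s)) : h.position L t ^ 2 ≤ s ^ 2 := by
  rw [sq_le_sq]
  rcases mem_uIcc.1 ht with ⟨h1, h2⟩ | ⟨h1, h2⟩ <;> rw [← travel_neg] at * <;>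
    have h1 := (h.position L).monotone h1 <;> have h2 := (h.position L).monotone h2 <;>
    rw [h.position_travel] at * <;> rw [abs_le]
  · exact ⟨by linarith [le_abs_self s], by linarith [le_abs_self s]⟩
  · exact ⟨by linarith [neg_abs_le s], by linarith [neg_abs_le s]⟩

/-! ### Sign of the variation field -/

/-- The numerator `s J_s - J` of the derivative collapses to `1 + (L² + s²) f(L² + s²)`, the
Wronskian of `s` and `J` in the variable `s`, which is positive inside the disk. -/
theorem IsGlobalProfile.strictMonoOn_jacobi_div (h : IsGlobalProfile R a f f₁ f₂) {L S : ℝ}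
    (hS : L ^ 2 + S ^ 2 ≤ R ^ 2) : StrictMonoOn (fun s => jacobi f f₁ L s / s) (Ioc 0 S) := by
  have hd : ∀ s : ℝ, s ≠ 0 → HasDerivAt (fun s => jacobi f f₁ L s / s)
      ((1 + (L ^ 2 + s ^ 2) * f (L ^ 2 + s ^ 2)) / s ^ 2) s := fun s hs => by
    refine ((h.hasDerivAt_jacobi L s).div (hasDerivAt_id s) hs).congr_deriv ?_
    simp only [id, jacobi]
    ring
  refine strictMonoOn_of_deriv_pos (convex_Ioc 0 S)
    (fun s hs => (hd s hs.1.ne').continuousAt.continuousWithinAt) fun s hs => ?_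
  rw [interior_Ioc] at hs
  rw [(hd s hs.1.ne').deriv]
  have := h.pos (L ^ 2 + s ^ 2) ⟨by positivity, by nlinarith [hs.1, hs.2]⟩
  have := hs.1
  positivity

theorem IsGlobalProfile.jacobi_zero_neg (h : IsGlobalProfile R a f f₁ f₂) {L : ℝ}
    (hL : L ^ 2 ≤ R ^ 2) : jacobi f f₁ L 0 < 0 := by
  have := h.pos (L ^ 2) ⟨by positivity, hL⟩
  simp only [jacobi, zero_pow two_ne_zero, add_zero, zero_mul]
  linarith

/-- Evenness reduces to `s ≥ 0`; there monotonicity of `J / s` carries the sign at `S` inwards. -/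
theorem IsGlobalProfile.jacobi_neg_of_neg (h : IsGlobalProfile R a f f₁ f₂) {L S s : ℝ}
    (hS : L ^ 2 + S ^ 2 ≤ R ^ 2) (hj : jacobi f f₁ L S < 0) (hs : s ∈ Icc (-S) S) :
    jacobi f f₁ L s < 0 := by
  wlog hs0 : 0 ≤ s generalizing s
  · rw [← jacobi_neg]
    exact this ⟨by linarith [hs.2], by linarith [hs.1]⟩ (by linarith)
  rcases hs0.eq_or_lt with rfl | hs0
  · exact h.jacobi_zero_neg (by nlinarith)
  have hS0 := hs0.trans_le hs.2
  have := (h.strictMonoOn_jacobi_div hS).monotoneOn ⟨hs0, hs.2⟩ ⟨hS0, le_rfl⟩ hs.2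
  have h2 : jacobi f f₁ L s / s < 0 := this.trans_lt (div_neg_of_neg_of_pos hj hS0)
  exact (div_neg_iff.1 h2).resolve_left (fun h => by linarith [h.2]) |>.1

/-- If the variation field is negative at the end, then no combination of it with the abscissa
vanishes twice. -/
theorem IsGlobalProfile.eq_of_jacobi_eq_mul (h : IsGlobalProfile R a f f₁ f₂) {L S c s₀ s₁ : ℝ}
    (hS : L ^ 2 + S ^ 2 ≤ R ^ 2) (hj : jacobi f f₁ L S < 0) (h₀ : s₀ ∈ Icc (-S) S)
    (h₁ : s₁ ∈ Icc (-S) S) (e₀ : jacobi f f₁ L s₀ = c * s₀) (e₁ : jacobi f f₁ L s₁ = c * s₁) :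
    s₀ = s₁ := by
  -- The reflection `s ↦ -s` fixes `J` and exchanges `c` and `-c`; `c = 0` would make `J` vanish.
  wlog hc : c < 0 generalizing c s₀ s₁
  · rcases (not_lt.1 hc).eq_or_lt with rfl | hc
    · have := h.jacobi_neg_of_neg hS hj h₀
      rw [e₀, zero_mul] at this
      exact absurd this (lt_irrefl _)
    · refine neg_injective (this (c := -c) ⟨?_, ?_⟩ ⟨?_, ?_⟩ ?_ ?_ (by linarith))
      any_goals rw [jacobi_neg, neg_mul_neg]; assumption
      all_goals linarith [h₀.1, h₀.2, h₁.1, h₁.2]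
  have key : ∀ s ∈ Icc (-S) S, jacobi f f₁ L s = c * s →
      s ∈ Ioc 0 S ∧ jacobi f f₁ L s / s = c := fun s hs e => by
    have hn := h.jacobi_neg_of_neg hS hj hs
    have h0 : 0 < s := by
      by_contra! h0
      nlinarith
    exact ⟨⟨h0, hs.2⟩, by rw [e, mul_div_cancel_right₀ _ h0.ne']⟩
  obtain ⟨m₀, d₀⟩ := key s₀ h₀ e₀
  obtain ⟨m₁, d₁⟩ := key s₁ h₁ e₁
  exact (h.strictMonoOn_jacobi_div hS).injOn m₀ m₁ (d₀.trans d₁.symm)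

end

/-! ### Integration of the geodesic equation -/

/-- `(j, j')` is a solution on `I` of the Jacobi equation with curvature `K`. -/
def IsJacobiOn (K j j' : ℝ → ℝ) (I : Set ℝ) : Prop :=
  ∀ t ∈ I, HasDerivWithinAt j (j' t) I t ∧ HasDerivWithinAt j' (-(K t * j t)) I t

theorem IsJacobiOn.wronskian_eq {K u u' v v' : ℝ → ℝ} {I : Set ℝ} (hu : IsJacobiOn K u u' I)
    (hv : IsJacobiOn K v v' I) (hI : Convex ℝ I) {s t : ℝ} (hs : s ∈ I) (ht : t ∈ I) :
    u t * v' t - u' t * v t = u s * v' s - u' s * v s :=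
  eq_of_hasDerivWithinAt_zero (g := fun t => u t * v' t - u' t * v t) hI (fun r hr =>
    (((hu r hr).1.mul (hv r hr).2).sub ((hu r hr).2.mul (hv r hr).1)).congr_deriv (by ring)) ht hs

section

variable {R : ℝ} {a f f₁ f₂ : ℝ → ℝ} {γ w γ' w' : ℝ → Plane} {I : Set ℝ} {t t₀ : ℝ}

theorem IsGlobalProfile.momentum_sq_add_sq_le (h : IsGlobalProfile R a f f₁ f₂)
    (hγ : IsGeodesicOn (disk R) (metric a) γ w I) (hI : Convex ℝ I) (ht₀ : t₀ ∈ I) (ht : t ∈ I) :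
    momentum (γ t₀) (w t₀) ^ 2 + abscissa f (γ t) (w t) ^ 2 ≤ R ^ 2 := by
  rw [h.abscissa_sq_add_sq hγ hI ht₀ ht]
  exact (h.isGeodesicOn_iff.1 hγ t ht).1

theorem IsGlobalProfile.travel_abscissa (h : IsGlobalProfile R a f f₁ f₂)
    (hγ : IsGeodesicOn (disk R) (metric a) γ w I) (hI : Convex ℝ I) (ht₀ : t₀ ∈ I) (ht : t ∈ I) :
    travel R f (momentum (γ t₀) (w t₀)) (abscissa f (γ t) (w t)) =
      travel R f (momentum (γ t₀) (w t₀)) (abscissa f (γ t₀) (w t₀)) + (t - t₀) := by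
  have := eq_of_hasDerivWithinAt_zero (I := I) (g := fun τ =>
    travel R f (momentum (γ t₀) (w t₀)) (abscissa f (γ τ) (w τ)) - τ) hI (fun τ hτ => by
      refine (((h.hasDerivAt_travel _ _).comp_hasDerivWithinAt τ
        (h.hasDerivWithinAt_abscissa hγ hτ)).sub (hasDerivWithinAt_id τ I)).congr_deriv ?_
      rw [h.abscissa_sq_add_sq hγ hI ht₀ hτ,
        extFactor_of_mem ⟨nsq_nonneg _, (h.isGeodesicOn_iff.1 hγ τ hτ).1⟩,
        mul_inv_cancel₀ (h.factor_pos hγ hτ).ne', sub_self]) ht ht₀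
  linarith

/-- The quantity `e^{-iψ} u` is constant, because `ψ` and the argument of `u` have the same rate of
change `L f / a`. -/
theorem IsGlobalProfile.twist_eq (h : IsGlobalProfile R a f f₁ f₂)
    (hγ : IsGeodesicOn (disk R) (metric a) γ w I) (hI : Convex ℝ I) (ht₀ : t₀ ∈ I) (ht : t ∈ I) :
    let ψ := fun τ => phase f (momentum (γ t₀) (w t₀)) (abscissa f (γ τ) (w τ))
    cos (ψ t) * twist₀ f (γ t) (w t) + sin (ψ t) * twist₁ f (γ t) (w t) =
      cos (ψ t₀) * twist₀ f (γ t₀) (w t₀) + sin (ψ t₀) * twist₁ f (γ t₀) (w t₀) ∧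
    cos (ψ t) * twist₁ f (γ t) (w t) - sin (ψ t) * twist₀ f (γ t) (w t) =
      cos (ψ t₀) * twist₁ f (γ t₀) (w t₀) - sin (ψ t₀) * twist₀ f (γ t₀) (w t₀) := by
  intro ψ
  have hψ : ∀ τ ∈ I, HasDerivWithinAt ψ (momentum (γ τ) (w τ) * f (nsq (γ τ)) *
      (1 + nsq (γ τ) * f (nsq (γ τ)))⁻¹) I τ := fun τ hτ => by
    refine ((h.hasDerivAt_phase _ _).comp_hasDerivWithinAt τ
      (h.hasDerivWithinAt_abscissa hγ hτ)).congr_deriv ?_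
    rw [h.abscissa_sq_add_sq hγ hI ht₀ hτ, h.momentum_eq hγ hI ht₀ hτ]
  constructor
  · refine eq_of_hasDerivWithinAt_zero (g := fun t => cos (ψ t) * twist₀ f (γ t) (w t) +
      sin (ψ t) * twist₁ f (γ t) (w t)) hI (fun τ hτ => ?_) ht ht₀
    exact (((hψ τ hτ).cos.mul (h.hasDerivWithinAt_twist₀ hγ hτ)).add
      ((hψ τ hτ).sin.mul (h.hasDerivWithinAt_twist₁ hγ hτ))).congr_deriv (by ring)
  · refine eq_of_hasDerivWithinAt_zero (g := fun t => cos (ψ t) * twist₁ f (γ t) (w t) -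
      sin (ψ t) * twist₀ f (γ t) (w t)) hI (fun τ hτ => ?_) ht ht₀
    exact (((hψ τ hτ).cos.mul (h.hasDerivWithinAt_twist₁ hγ hτ)).sub
      ((hψ τ hτ).sin.mul (h.hasDerivWithinAt_twist₀ hγ hτ))).congr_deriv (by ring)

/-- Geodesics are determined by their initial values. -/
theorem IsGlobalProfile.geodesic_eq (h : IsGlobalProfile R a f f₁ f₂)
    (hγ : IsGeodesicOn (disk R) (metric a) γ w I) (hγ' : IsGeodesicOn (disk R) (metric a) γ' w' I)
    (hI : Convex ℝ I) (ht₀ : t₀ ∈ I) (ht : t ∈ I) (h0 : γ t₀ = γ' t₀) (h1 : w t₀ = w' t₀) :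
    γ t = γ' t := by
  have hs : abscissa f (γ t) (w t) = abscissa f (γ' t) (w' t) := by
    apply (h.strictMono_travel (momentum (γ t₀) (w t₀))).injective
    rw [h.travel_abscissa hγ hI ht₀ ht]
    simp only [h0, h1]
    rw [h.travel_abscissa hγ' hI ht₀ ht]
  have hL : momentum (γ t) (w t) = momentum (γ' t) (w' t) := by
    rw [h.momentum_eq hγ hI ht₀ ht, h.momentum_eq hγ' hI ht₀ ht, h0, h1]
  obtain ⟨h2, h3⟩ := h.twist_eq hγ hI ht₀ ht
  obtain ⟨h4, h5⟩ := h.twist_eq hγ' hI ht₀ ht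
  simp only [h0, h1, hs] at h2 h3
  dsimp only at h4 h5
  rw [← h4] at h2
  rw [← h5] at h3
  -- Both curves now have the same angle `ψ`, so undoing the rotation by `ψ` identifies their
  -- twists.
  generalize phase f (momentum (γ' t₀) (w' t₀)) (abscissa f (γ' t) (w' t)) = ψ at h2 h3
  have hsc := sin_sq_add_cos_sq ψ
  have e0 : twist₀ f (γ t) (w t) = twist₀ f (γ' t) (w' t) := by
    linear_combination cos ψ * h2 - sin ψ * h3 -
      (twist₀ f (γ t) (w t) - twist₀ f (γ' t) (w' t)) * hsc
  have e1 : twist₁ f (γ t) (w t) = twist₁ f (γ' t) (w' t) := by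
    linear_combination sin ψ * h2 + cos ψ * h3 -
      (twist₁ f (γ t) (w t) - twist₁ f (γ' t) (w' t)) * hsc
  have u := (h.isGeodesicOn_iff.1 hγ t ht).2.1
  have u' := (h.isGeodesicOn_iff.1 hγ' t ht).2.1
  ext i
  fin_cases i
  · exact (apply_zero_eq f u).trans (by rw [e0, e1, hs, hL, ← apply_zero_eq f u']; rfl)
  · exact (apply_one_eq f u).trans (by rw [e0, e1, hs, hL, ← apply_one_eq f u']; rfl)

/-- The abscissa stays in `[-R, R]` and `dt/ds = a` is bounded, so no geodesic lasts longer than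
`2R` times that bound. -/
theorem IsGlobalProfile.isNonTrapping (h : IsGlobalProfile R a f f₁ f₂) :
    IsNonTrapping (disk R) (metric a) := by
  obtain ⟨m, hm⟩ := h.exists_extFactor_le
  have hR := h.radius_pos
  refine lt_of_le_of_lt (b := ENNReal.ofReal (m * (2 * R))) ?_ ENNReal.ofReal_lt_top
  refine iSup₂_le fun p _ => iSup₂_le ?_
  rintro T ⟨γ, w, hγ, -, -⟩
  have hT0 : (0 : ℝ) ∈ Icc 0 (T : ℝ) := ⟨le_rfl, T.2⟩
  have hT1 : (T : ℝ) ∈ Icc 0 (T : ℝ) := ⟨T.2, le_rfl⟩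
  have e := h.travel_abscissa hγ (convex_Icc _ _) hT0 hT1
  have b0 := h.momentum_sq_add_sq_le hγ (convex_Icc _ _) hT0 hT0
  have b1 := h.momentum_sq_add_sq_le hγ (convex_Icc _ _) hT0 hT1
  set s₀ := abscissa f (γ 0) (w 0)
  set s₁ := abscissa f (γ T) (w T)
  set L := momentum (γ 0) (w 0)
  have a0 := abs_le_of_sq_le_sq' (show s₀ ^ 2 ≤ R ^ 2 by nlinarith) hR.le
  have a1 := abs_le_of_sq_le_sq' (show s₁ ^ 2 ≤ R ^ 2 by nlinarith) hR.le
  have hl := (convex_univ (𝕜 := ℝ) (E := ℝ)).norm_image_sub_le_of_norm_hasDerivWithin_le (C := m)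
    (fun s _ => (h.hasDerivAt_travel L s).hasDerivWithinAt)
    (fun s _ => by rw [norm_of_nonneg (h.extFactor_pos _).le]; exact hm _)
    (mem_univ s₀) (mem_univ s₁)
  rw [e, add_sub_cancel_left, sub_zero, norm_of_nonneg T.coe_nonneg, norm_eq_abs] at hl
  have hm0 : 0 ≤ m := (h.extFactor_pos 0).le.trans (hm 0)
  have : (T : ℝ) ≤ m * (2 * R) := hl.trans (mul_le_mul_of_nonneg_left
    (abs_le.2 ⟨by linarith, by linarith⟩) hm0)
  rw [← ENNReal.ofReal_coe_nnreal]
  exact ENNReal.ofReal_le_ofReal this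

/-! ### Jacobi fields -/

theorem IsGlobalProfile.hasDerivWithinAt_inv_factor (h : IsGlobalProfile R a f f₁ f₂)
    (hγ : IsGeodesicOn (disk R) (metric a) γ w I) (ht : t ∈ I) :
    HasDerivWithinAt (fun τ => (1 + nsq (γ τ) * f (nsq (γ τ)))⁻¹)
      (-(gaussCurvature (disk R) (metric a) (γ t) * abscissa f (γ t) (w t))) I t := by
  have hp := h.factor_pos hγ ht
  refine ((h.hasDerivWithinAt_factor hγ ht).inv hp.ne').congr_deriv ?_
  rw [h.gaussCurvature_eq (hγ t ht).1.1, abscissa]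
  field_simp

/-- The abscissa is the normal component of the rotation field, a Killing field. -/
theorem IsGlobalProfile.isJacobiOn_abscissa (h : IsGlobalProfile R a f f₁ f₂)
    (hγ : IsGeodesicOn (disk R) (metric a) γ w I) :
    IsJacobiOn (fun t => gaussCurvature (disk R) (metric a) (γ t))
      (fun t => abscissa f (γ t) (w t)) (fun t => (1 + nsq (γ t) * f (nsq (γ t)))⁻¹) I :=
  fun _ ht => ⟨h.hasDerivWithinAt_abscissa hγ ht, h.hasDerivWithinAt_inv_factor hγ ht⟩

theorem IsGlobalProfile.isJacobiOn_jacobi (h : IsGlobalProfile R a f f₁ f₂)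
    (hγ : IsGeodesicOn (disk R) (metric a) γ w I) (hI : Convex ℝ I) (ht₀ : t₀ ∈ I) :
    IsJacobiOn (fun t => gaussCurvature (disk R) (metric a) (γ t))
      (fun t => jacobi f f₁ (momentum (γ t₀) (w t₀)) (abscissa f (γ t) (w t)))
      (fun t => (phaseVar f f₁ (momentum (γ t₀) (w t₀)) (abscissa f (γ t) (w t))
        + abscissa f (γ t) (w t) * f (nsq (γ t))) * (1 + nsq (γ t) * f (nsq (γ t)))⁻¹) I := by
  intro t ht
  have hs := h.hasDerivWithinAt_abscissa hγ ht
  have hp := h.factor_pos hγ ht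
  have hn := h.abscissa_sq_add_sq hγ hI ht₀ ht
  constructor
  · refine ((h.hasDerivAt_jacobi _ _).comp_hasDerivWithinAt t hs).congr_deriv ?_
    rw [hn]
  · refine ((((h.hasDerivAt_phaseVar _ _).comp_hasDerivWithinAt t hs).add
      (hs.mul (h.hasDerivWithinAt_profile hγ ht))).mul
      (h.hasDerivWithinAt_inv_factor hγ ht)).congr_deriv ?_
    have hd : dot (γ t) (w t) =
        abscissa f (γ t) (w t) * (1 + nsq (γ t) * f (nsq (γ t)))⁻¹ := by
      rw [abscissa]; field_simp
    simp only [hn, hd, Pi.add_apply, Pi.mul_apply, Function.comp_apply, jacobi,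
      h.gaussCurvature_eq (hγ t ht).1.1]
    generalize abscissa f (γ t) (w t) = s at hn ⊢
    generalize momentum (γ t₀) (w t₀) = L at hn ⊢
    generalize phaseVar f f₁ L s = P
    obtain ⟨e, he⟩ : ∃ e, e = 1 + nsq (γ t) * f (nsq (γ t)) := ⟨_, rfl⟩
    rw [← he] at hp ⊢
    field_simp
    rw [he]
    generalize f (nsq (γ t)) = F
    generalize f₁ (nsq (γ t)) = F₁
    rw [← hn]
    ring

/-- Wronskians express any Jacobi field through `s` and `J`; two zeros would make the pairs `(s, J)`
at those times proportional, which `eq_of_jacobi_eq_mul` forbids. -/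
theorem IsGlobalProfile.not_hasConjugatePoints (h : IsGlobalProfile R a f f₁ f₂)
    (hneg : ∀ L S, 0 < S → L ^ 2 + S ^ 2 = R ^ 2 → jacobi f f₁ L S < 0) :
    ¬ HasConjugatePoints (disk R) (metric a) := by
  rintro ⟨t₀, t₁, γ, w, j, j', htt, hγ, hj, ⟨t, ht, hjt⟩, hj0, hj1⟩
  have hI := convex_Icc (𝕜 := ℝ) t₀ t₁
  have m0 : t₀ ∈ Icc t₀ t₁ := ⟨le_rfl, htt.le⟩
  have m1 : t₁ ∈ Icc t₀ t₁ := ⟨htt.le, le_rfl⟩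
  have hj' : IsJacobiOn (fun t => gaussCurvature (disk R) (metric a) (γ t)) j j' (Icc t₀ t₁) := hj
  have hs := h.isJacobiOn_abscissa hγ
  have hJ := h.isJacobiOn_jacobi hγ hI m0
  have hst := h.travel_abscissa hγ hI m0 m1
  have hb := fun {t} => h.momentum_sq_add_sq_le (t := t) hγ hI m0
  have hn := h.abscissa_sq_add_sq hγ hI m0 ht
  set L := momentum (γ t₀) (w t₀)
  have hlt : abscissa f (γ t₀) (w t₀) < abscissa f (γ t₁) (w t₁) := by
    rw [← (h.strictMono_travel L).lt_iff_lt, hst]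
    linarith
  have v0 := hj'.wronskian_eq hs hI m0 m1
  have v1 := hj'.wronskian_eq hJ hI m0 m1
  have w0 := hj'.wronskian_eq hs hI m0 ht
  have w1 := hj'.wronskian_eq hJ hI m0 ht
  simp only [hj0, hj1, zero_mul, zero_sub] at v0 v1 w0 w1
  -- The Wronskian of `s` and `J` is `1`, so the Wronskians of `j` with them are its coordinates in
  -- this basis.
  have hw : abscissa f (γ t) (w t) * ((phaseVar f f₁ L (abscissa f (γ t) (w t))
      + abscissa f (γ t) (w t) * f (nsq (γ t))) * (1 + nsq (γ t) * f (nsq (γ t)))⁻¹)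
      - (1 + nsq (γ t) * f (nsq (γ t)))⁻¹ * jacobi f f₁ L (abscissa f (γ t) (w t)) = 1 := by
    have hp := h.factor_pos hγ ht
    rw [jacobi, hn]
    obtain ⟨e, he⟩ : ∃ e, e = 1 + nsq (γ t) * f (nsq (γ t)) := ⟨_, rfl⟩
    rw [← he] at hp ⊢
    field_simp
    linear_combination f (nsq (γ t)) * hn - he
  have hjt' : j t = abscissa f (γ t) (w t) * (-(j' t₀ * jacobi f f₁ L (abscissa f (γ t₀) (w t₀))))
      - jacobi f f₁ L (abscissa f (γ t) (w t)) * (-(j' t₀ * abscissa f (γ t₀) (w t₀))) := by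
    rw [← w0, ← w1]
    linear_combination -(j t) * hw
  have hS0 : 0 ≤ R ^ 2 - L ^ 2 := by nlinarith [hb m0, sq_nonneg (abscissa f (γ t₀) (w t₀))]
  have hSS := sq_sqrt hS0
  have hmem : ∀ τ ∈ Icc t₀ t₁, abscissa f (γ τ) (w τ) ∈ Icc (-√(R ^ 2 - L ^ 2)) √(R ^ 2 - L ^ 2) :=
    fun τ hτ => abs_le_of_sq_le_sq' (by rw [hSS]; linarith [hb hτ]) (sqrt_nonneg _)
  have hSp : 0 < √(R ^ 2 - L ^ 2) := by linarith [(hmem t₀ m0).1, (hmem t₁ m1).2]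
  have hJS := hneg L _ hSp (by rw [hSS]; ring)
  have hle : L ^ 2 + √(R ^ 2 - L ^ 2) ^ 2 ≤ R ^ 2 := by rw [hSS]; linarith
  have hp0 : j' t₀ ≠ 0 := fun h0 => hjt (by rw [hjt', h0]; ring)
  have hp1 : j' t₁ ≠ 0 := fun h1 => by
    rw [h1, zero_mul, neg_zero, zero_eq_neg] at v0 v1
    have e1 := (mul_eq_zero.1 v1).resolve_left hp0
    exact absurd e1 (h.jacobi_neg_of_neg hle hJS (hmem t₀ m0)).ne
  -- By `v0` and `v1`, the pair `(s, J)` times `j'` is the same at `t₀` and `t₁`. Either `s`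
  -- vanishes at both times, or `J / s` has a common value `c`.
  by_cases hz : abscissa f (γ t₀) (w t₀) = 0
  · rw [hz, mul_zero, neg_zero, neg_eq_zero] at v0
    have := (mul_eq_zero.1 v0).resolve_left hp1
    exact hlt.ne (hz.trans this.symm)
  · set c := jacobi f f₁ L (abscissa f (γ t₀) (w t₀)) / abscissa f (γ t₀) (w t₀) with hc
    have e0 : jacobi f f₁ L (abscissa f (γ t₀) (w t₀)) = c * abscissa f (γ t₀) (w t₀) := by
      rw [hc, div_mul_cancel₀ _ hz]
    refine hlt.ne (h.eq_of_jacobi_eq_mul hle hJS (hmem t₀ m0) (hmem t₁ m1) e0 ?_)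
    refine mul_left_cancel₀ hp1 ?_
    rw [e0] at v1
    linear_combination c * v0 - v1

end

/-! ### Explicit geodesics -/

/-- The geodesics of angular momentum `L`, parametrized by the abscissa: the twisted line
`exp (i (φ + phase f L s)) (s - i L)`. -/
def lineCurve (f : ℝ → ℝ) (L φ s : ℝ) : Plane :=
  !₂[cos (φ + phase f L s) * s + sin (φ + phase f L s) * L,
    sin (φ + phase f L s) * s - cos (φ + phase f L s) * L]

/-- The unit tangent vectors of `lineCurve f L φ`. -/
def lineVelocity (f : ℝ → ℝ) (L φ s : ℝ) : Plane :=
  !₂[(cos (φ + phase f L s) * (1 + L ^ 2 * f (L ^ 2 + s ^ 2))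
      - sin (φ + phase f L s) * (L * s * f (L ^ 2 + s ^ 2)))
        * (1 + (L ^ 2 + s ^ 2) * f (L ^ 2 + s ^ 2))⁻¹,
    (sin (φ + phase f L s) * (1 + L ^ 2 * f (L ^ 2 + s ^ 2))
      + cos (φ + phase f L s) * (L * s * f (L ^ 2 + s ^ 2)))
        * (1 + (L ^ 2 + s ^ 2) * f (L ^ 2 + s ^ 2))⁻¹]

section

variable {R : ℝ} {a f f₁ f₂ : ℝ → ℝ}

theorem nsq_lineCurve (f : ℝ → ℝ) (L φ s : ℝ) : nsq (lineCurve f L φ s) = L ^ 2 + s ^ 2 := by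
  simp [nsq, lineCurve]
  linear_combination (L ^ 2 + s ^ 2) * sin_sq_add_cos_sq (φ + phase f L s)

theorem dot_lineCurve (f : ℝ → ℝ) (L φ s : ℝ) :
    dot (lineCurve f L φ s) (lineVelocity f L φ s) =
      s * (1 + (L ^ 2 + s ^ 2) * f (L ^ 2 + s ^ 2))⁻¹ := by
  simp [dot, lineCurve, lineVelocity]
  linear_combination s * (1 + (L ^ 2 + s ^ 2) * f (L ^ 2 + s ^ 2))⁻¹
    * sin_sq_add_cos_sq (φ + phase f L s)

theorem nsq_lineVelocity (f : ℝ → ℝ) (L φ s : ℝ) :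
    nsq (lineVelocity f L φ s) =
      ((1 + L ^ 2 * f (L ^ 2 + s ^ 2)) ^ 2 + (L * s * f (L ^ 2 + s ^ 2)) ^ 2)
        * (1 + (L ^ 2 + s ^ 2) * f (L ^ 2 + s ^ 2))⁻¹ ^ 2 := by
  simp [nsq, lineVelocity, -mul_inv_rev, -inv_pow]
  generalize (1 + (L ^ 2 + s ^ 2) * f (L ^ 2 + s ^ 2))⁻¹ = e
  linear_combination ((1 + L ^ 2 * f (L ^ 2 + s ^ 2)) ^ 2 + (L * s * f (L ^ 2 + s ^ 2)) ^ 2)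
    * e ^ 2 * sin_sq_add_cos_sq (φ + phase f L s)

theorem momentum_lineCurve {f : ℝ → ℝ} {L s : ℝ} (φ : ℝ)
    (hp : 1 + (L ^ 2 + s ^ 2) * f (L ^ 2 + s ^ 2) ≠ 0) :
    momentum (lineCurve f L φ s) (lineVelocity f L φ s) = L := by
  simp [momentum, lineCurve, lineVelocity]
  linear_combination L * (1 + (L ^ 2 + s ^ 2) * f (L ^ 2 + s ^ 2))
    * (1 + (L ^ 2 + s ^ 2) * f (L ^ 2 + s ^ 2))⁻¹ * sin_sq_add_cos_sq (φ + phase f L s)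
    + L * mul_inv_cancel₀ hp

theorem abscissa_lineCurve {f : ℝ → ℝ} {L s : ℝ} (φ : ℝ)
    (hp : 1 + (L ^ 2 + s ^ 2) * f (L ^ 2 + s ^ 2) ≠ 0) :
    abscissa f (lineCurve f L φ s) (lineVelocity f L φ s) = s := by
  rw [abscissa, dot_lineCurve, nsq_lineCurve]
  field_simp

/-- Here `D` is the time of passage at abscissa `0`. -/
theorem IsGlobalProfile.isGeodesicOn_lineCurve (h : IsGlobalProfile R a f f₁ f₂) (L φ D : ℝ)
    {I : Set ℝ} (hI : ∀ t ∈ I, L ^ 2 + h.position L (t - D) ^ 2 ≤ R ^ 2) :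
    IsGeodesicOn (disk R) (metric a) (fun t => lineCurve f L φ (h.position L (t - D)))
      (fun t => lineVelocity f L φ (h.position L (t - D))) I := by
  refine h.isGeodesicOn_iff.2 fun t ht => ?_
  have hmem : L ^ 2 + h.position L (t - D) ^ 2 ∈ Icc 0 (R ^ 2) := ⟨by positivity, hI t ht⟩
  have hp := h.pos _ hmem
  have hσ := ((h.hasDerivAt_position L (t - D)).comp_sub_const t D)
  rw [extFactor_of_mem hmem] at hσ
  simp only [sprayCoeff, dot_lineCurve, nsq_lineVelocity, nsq_lineCurve]
  have hc : HasDerivAt (fun t => cos (φ + phase f L (h.position L (t - D)))) _ t :=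
    (((h.hasDerivAt_phase L _).comp t hσ).const_add φ).cos
  have hs : HasDerivAt (fun t => sin (φ + phase f L (h.position L (t - D)))) _ t :=
    (((h.hasDerivAt_phase L _).comp t hσ).const_add φ).sin
  have hf : HasDerivAt (fun t => f (L ^ 2 + h.position L (t - D) ^ 2)) _ t :=
    (hasDerivAt_comp_sq (h.hasDerivAt _)).comp t hσ
  have hA : HasDerivAt (fun t => 1 + (L ^ 2 + h.position L (t - D) ^ 2)
      * f (L ^ 2 + h.position L (t - D) ^ 2)) _ t :=
    (((hσ.pow 2).const_add (L ^ 2)).mul hf).const_add 1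
  have hN := (hf.const_mul (L ^ 2)).const_add 1
  have hM := (hσ.const_mul L).mul hf
  refine ⟨hI t ht, ?_, ⟨?_, ?_⟩, ?_, ?_⟩
  · rw [coeff]
    field_simp
    ring
  · refine ((hc.mul hσ).add (hs.mul_const L)).hasDerivWithinAt.congr_deriv ?_
    simp [lineVelocity]
    ring
  · refine ((hs.mul hσ).sub (hc.mul_const L)).hasDerivWithinAt.congr_deriv ?_
    simp [lineVelocity]
    ring
  · refine (((hc.mul hN).sub (hs.mul hM)).mul (hA.inv hp.ne')).hasDerivWithinAt.congr_deriv ?_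
    simp [lineCurve, coeff, coeff₁]
    generalize cos (φ + phase f L (h.position L (t - D))) = c
    generalize sin (φ + phase f L (h.position L (t - D))) = d
    generalize h.position L (t - D) = s at hp ⊢
    obtain ⟨e, he⟩ : ∃ e, e = 1 + (L ^ 2 + s ^ 2) * f (L ^ 2 + s ^ 2) := ⟨_, rfl⟩
    rw [← he] at hp ⊢
    generalize f (L ^ 2 + s ^ 2) = F at he ⊢
    generalize f₁ (L ^ 2 + s ^ 2) = F₁
    field_simp
    rw [he]
    ring
  · refine (((hs.mul hN).add (hc.mul hM)).mul (hA.inv hp.ne')).hasDerivWithinAt.congr_deriv ?_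
    simp [lineCurve, coeff, coeff₁]
    generalize cos (φ + phase f L (h.position L (t - D))) = c
    generalize sin (φ + phase f L (h.position L (t - D))) = d
    generalize h.position L (t - D) = s at hp ⊢
    obtain ⟨e, he⟩ : ∃ e, e = 1 + (L ^ 2 + s ^ 2) * f (L ^ 2 + s ^ 2) := ⟨_, rfl⟩
    rw [← he] at hp ⊢
    generalize f (L ^ 2 + s ^ 2) = F at he ⊢
    generalize f₁ (L ^ 2 + s ^ 2) = F₁
    field_simp
    rw [he]
    ring

end

/-! ### The scattering function -/

/-- An explicit formula for the scattering function. -/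
def scatteringAngle (R : ℝ) (f : ℝ → ℝ) (α : ℝ) : ℝ := α + phase f (-(R * sin α)) (R * cos α)

/-- Rescaling to `[0, 1]` removes the parameter from the limits of integration. -/
theorem integral_comp_sq (g : ℝ → ℝ) (L s : ℝ) :
    ∫ σ in 0..s, g (L ^ 2 + σ ^ 2) = s * ∫ u in 0..1, g (L ^ 2 + s ^ 2 * u ^ 2) := by
  have := intervalIntegral.mul_integral_comp_mul_left (a := 0) (b := 1)
    (f := fun σ => g (L ^ 2 + σ ^ 2)) s
  simpa only [mul_zero, mul_one, mul_pow] using this.symm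

section

variable {R : ℝ} {a f f₁ f₂ : ℝ → ℝ}

theorem IsGlobalProfile.hasDerivAt_integral (h : IsGlobalProfile R a f f₁ f₂) (α : ℝ) :
    HasDerivAt (fun α => ∫ u in 0..1, f (R ^ 2 * sin α ^ 2 + R ^ 2 * cos α ^ 2 * u ^ 2))
      (∫ u in 0..1, f₁ (R ^ 2 * sin α ^ 2 + R ^ 2 * cos α ^ 2 * u ^ 2) *
        (2 * R ^ 2 * sin α * cos α * (1 - u ^ 2))) α := by
  have hc := h.continuous
  have hc' := h.continuous'
  obtain ⟨M, hM⟩ := isCompact_Icc.exists_bound_of_continuousOn (s := Icc 0 (R ^ 2))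
    hc'.continuousOn
  have hM0 : 0 ≤ M := (norm_nonneg _).trans (hM 0 ⟨le_rfl, sq_nonneg R⟩)
  refine (intervalIntegral.hasDerivAt_integral_of_dominated_loc_of_deriv_le
    (μ := MeasureTheory.volume) (bound := fun _ => M * (2 * R ^ 2)) (s := univ)
    (F := fun α u => f (R ^ 2 * sin α ^ 2 + R ^ 2 * cos α ^ 2 * u ^ 2))
    (F' := fun α u => f₁ (R ^ 2 * sin α ^ 2 + R ^ 2 * cos α ^ 2 * u ^ 2) *
        (2 * R ^ 2 * sin α * cos α * (1 - u ^ 2))) Filter.univ_mem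
    (Filter.Eventually.of_forall fun x => Continuous.aestronglyMeasurable (by fun_prop))
    (Continuous.intervalIntegrable (by fun_prop) _ _)
    (Continuous.aestronglyMeasurable (by fun_prop)) ?_ (by simp) ?_).2
  · refine Filter.Eventually.of_forall fun u hu x _ => ?_
    rw [uIoc_of_le zero_le_one] at hu
    have hu2 : u ^ 2 ≤ 1 := pow_le_one₀ hu.1.le hu.2
    have hsc := sin_sq_add_cos_sq x
    rw [norm_mul]
    refine mul_le_mul (hM _ ⟨by positivity, ?_⟩) ?_ (norm_nonneg _) hM0
    · have : cos x ^ 2 * u ^ 2 ≤ cos x ^ 2 := mul_le_of_le_one_right (by positivity) hu2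
      calc R ^ 2 * sin x ^ 2 + R ^ 2 * cos x ^ 2 * u ^ 2
          = R ^ 2 * (sin x ^ 2 + cos x ^ 2 * u ^ 2) := by ring
        _ ≤ R ^ 2 * 1 := mul_le_mul_of_nonneg_left (by linarith) (by positivity)
        _ = R ^ 2 := mul_one _
    · rw [norm_eq_abs, abs_mul, abs_mul, abs_mul, abs_of_nonneg (by positivity : 0 ≤ 2 * R ^ 2),
        abs_of_nonneg (by linarith : 0 ≤ 1 - u ^ 2)]
      calc 2 * R ^ 2 * |sin x| * |cos x| * (1 - u ^ 2)
          ≤ 2 * R ^ 2 * 1 * 1 * 1 := by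
            gcongr
            · exact abs_sin_le_one x
            · exact abs_cos_le_one x
            · linarith [sq_nonneg u]
        _ = 2 * R ^ 2 := by ring
  · refine Filter.Eventually.of_forall fun u _ x _ => ?_
    refine (h.hasDerivAt _).comp x ((((hasDerivAt_sin x).pow 2).const_mul (R ^ 2)).add
      ((((hasDerivAt_cos x).pow 2).const_mul (R ^ 2)).mul_const (u ^ 2)) |>.congr_deriv ?_)
    simp
    ring

/-- For `L = -R sin α` and `S = R cos α` one has `L' = -S` and `S' = L`, so formally `ς' = 1 - S ∂_L
phase + L · L f(R²) = -J(L, S)`. -/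
theorem IsGlobalProfile.hasDerivAt_scatteringAngle (h : IsGlobalProfile R a f f₁ f₂) (α : ℝ) :
    HasDerivAt (scatteringAngle R f) (-jacobi f f₁ (-(R * sin α)) (R * cos α)) α := by
  have hc := h.continuous
  have hc' := h.continuous'
  have hsc := sin_sq_add_cos_sq α
  have e : scatteringAngle R f = fun α => α - R ^ 2 * (sin α * cos α *
      ∫ u in 0..1, f (R ^ 2 * sin α ^ 2 + R ^ 2 * cos α ^ 2 * u ^ 2)) := by
    funext α
    rw [scatteringAngle, phase, integral_comp_sq]
    simp only [neg_sq, mul_pow]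
    ring
  rw [e]
  refine ((hasDerivAt_id α).sub ((((hasDerivAt_sin α).mul (hasDerivAt_cos α)).mul
    (h.hasDerivAt_integral α)).const_mul (R ^ 2))).congr_deriv ?_
  -- Integrating the derivative of `u f(L² + S² u²)` recovers the endpoint term `f(R²)` that the
  -- rescaling has hidden.
  have e1 : f (R ^ 2) = ∫ u in 0..1, (f (R ^ 2 * sin α ^ 2 + R ^ 2 * cos α ^ 2 * u ^ 2) +
      2 * R ^ 2 * cos α ^ 2 * (u ^ 2 * f₁ (R ^ 2 * sin α ^ 2 + R ^ 2 * cos α ^ 2 * u ^ 2))) := by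
    rw [intervalIntegral.integral_eq_sub_of_hasDerivAt
      (f := fun u => u * f (R ^ 2 * sin α ^ 2 + R ^ 2 * cos α ^ 2 * u ^ 2)) (fun u _ => ?_)
      (Continuous.intervalIntegrable (by fun_prop) _ _)]
    · rw [one_pow, mul_one, ← mul_add, hsc]; simp
    · refine ((hasDerivAt_id u).mul ((h.hasDerivAt _).comp u (((hasDerivAt_pow 2 u).const_mul
        (R ^ 2 * cos α ^ 2)).const_add (R ^ 2 * sin α ^ 2)))).congr_deriv ?_
      simp
      ring
  have e2 : phaseVar f f₁ (-(R * sin α)) (R * cos α) = R * cos α *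
      ∫ u in 0..1, (f (R ^ 2 * sin α ^ 2 + R ^ 2 * cos α ^ 2 * u ^ 2) +
        2 * R ^ 2 * sin α ^ 2 * f₁ (R ^ 2 * sin α ^ 2 + R ^ 2 * cos α ^ 2 * u ^ 2)) := by
    rw [phaseVar, integral_comp_sq (fun t => f t + 2 * (-(R * sin α)) ^ 2 * f₁ t)]
    simp only [neg_sq, mul_pow, mul_assoc]
  have e3 : ∀ u : ℝ, f₁ (R ^ 2 * sin α ^ 2 + R ^ 2 * cos α ^ 2 * u ^ 2) *
      (2 * R ^ 2 * sin α * cos α * (1 - u ^ 2)) = 2 * R ^ 2 * sin α * cos α *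
      (f₁ (R ^ 2 * sin α ^ 2 + R ^ 2 * cos α ^ 2 * u ^ 2)
        - u ^ 2 * f₁ (R ^ 2 * sin α ^ 2 + R ^ 2 * cos α ^ 2 * u ^ 2)) := fun u => by ring
  have e4 : (-(R * sin α)) ^ 2 + (R * cos α) ^ 2 = R ^ 2 := by
    linear_combination R ^ 2 * hsc
  rw [intervalIntegral.integral_add (Continuous.intervalIntegrable (by fun_prop) _ _)
    (Continuous.intervalIntegrable (by fun_prop) _ _), intervalIntegral.integral_const_mul]
    at e1 e2
  simp only [e3, Pi.mul_apply]
  rw [intervalIntegral.integral_const_mul, intervalIntegral.integral_sub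
    (Continuous.intervalIntegrable (by fun_prop) _ _)
    (Continuous.intervalIntegrable (by fun_prop) _ _), jacobi, e4, e2, e1]
  ring

/-! ### Conjugate points and simplicity -/

theorem IsGlobalProfile.jacobi_neg_iff (h : IsGlobalProfile R a f f₁ f₂) :
    (∀ L S, 0 < S → L ^ 2 + S ^ 2 = R ^ 2 → jacobi f f₁ L S < 0) ↔
      ∀ α ∈ Icc (-(π / 2)) (π / 2), 0 < deriv (scatteringAngle R f) α := by
  have hR := h.radius_pos
  have hd : ∀ α, deriv (scatteringAngle R f) α = _ :=
    fun α => (h.hasDerivAt_scatteringAngle α).deriv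
  simp only [hd, neg_pos]
  constructor
  · intro hj α hα
    have hcos := cos_nonneg_of_mem_Icc hα
    rcases hcos.eq_or_lt with hc | hc
    -- At `α = ±π/2` one has `S = 0`, and `J(0) < 0` always holds.
    · rw [← hc, mul_zero]
      refine h.jacobi_zero_neg ?_
      nlinarith [sin_sq_add_cos_sq α, sq_nonneg R, sq_nonneg (cos α)]
    · exact hj _ _ (by positivity) (by linear_combination R ^ 2 * sin_sq_add_cos_sq α)
  · intro hj L S hS hLS
    have hb : |L / R| ≤ 1 := by
      rw [abs_le_one_iff_mul_self_le_one, div_mul_div_comm, div_le_one (by positivity)]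
      nlinarith
    have h1 := abs_le.1 hb
    have := hj (-arcsin (L / R)) ⟨neg_le_neg (arcsin_le_pi_div_two _),
      neg_le.1 (neg_pi_div_two_le_arcsin _)⟩
    rw [sin_neg, cos_neg, sin_arcsin h1.1 h1.2, cos_arcsin, mul_neg, neg_neg,
      mul_div_cancel₀ _ hR.ne'] at this
    have hs : R * √(1 - (L / R) ^ 2) = S := by
      have : 1 - (L / R) ^ 2 = (S / R) ^ 2 := by
        field_simp
        linarith
      rw [this, sqrt_sq (by positivity), mul_div_cancel₀ _ hR.ne']
    rwa [hs] at this

/-- By continuity `J` has a zero `s` in `(0, S]`, and by evenness also at `-s`; `J` itself is the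
required Jacobi field. -/
theorem IsGlobalProfile.hasConjugatePoints (h : IsGlobalProfile R a f f₁ f₂) {L S : ℝ}
    (hS : 0 < S) (hLS : L ^ 2 + S ^ 2 = R ^ 2) (hj : 0 ≤ jacobi f f₁ L S) :
    HasConjugatePoints (disk R) (metric a) := by
  have hcont : ContinuousOn (jacobi f f₁ L) (Icc 0 S) :=
    fun s _ => (h.hasDerivAt_jacobi L s).continuousAt.continuousWithinAt
  have h0 : jacobi f f₁ L 0 < 0 := h.jacobi_zero_neg (by nlinarith)
  obtain ⟨s, hs, hs0⟩ := intermediate_value_Icc hS.le hcont ⟨h0.le, hj⟩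
  have hspos : 0 < s := hs.1.lt_of_ne (by rintro rfl; exact h0.ne hs0)
  have htr : 0 < travel R f L s := by
    rw [← travel_zero R f L]; exact h.strictMono_travel L hspos
  set T := travel R f L s with hT
  have hmem : ∀ t ∈ Icc (-T) T, L ^ 2 + h.position L (t - 0) ^ 2 ≤ R ^ 2 := fun t ht => by
    have := h.position_sq_le (L := L) (s := s) (t := t) (by
      rw [uIcc_of_le (by linarith)]; exact ht)
    rw [sub_zero]
    nlinarith [hs.1, hs.2]
  have hγ := h.isGeodesicOn_lineCurve L 0 0 hmem
  have m0 : (0 : ℝ) ∈ Icc (-T) T := ⟨by linarith, htr.le⟩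
  have hJ := h.isJacobiOn_jacobi hγ (convex_Icc _ _) m0
  have hab : ∀ t ∈ Icc (-T) T, abscissa f (lineCurve f L 0 (h.position L (t - 0)))
      (lineVelocity f L 0 (h.position L (t - 0))) = h.position L t := fun t ht => by
    rw [abscissa_lineCurve _ (h.pos _ ⟨by positivity, hmem t ht⟩).ne', sub_zero]
  have hmo := momentum_lineCurve 0 (h.pos _ ⟨by positivity, hmem 0 m0⟩).ne'
  simp only [hmo] at hJ
  refine ⟨-T, T, _, _, _, _, by linarith, hγ, hJ, ⟨0, m0, ?_⟩, ?_, ?_⟩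
  · have hp0 : h.position L 0 = 0 := by simpa using h.position_travel L 0
    rw [hab 0 m0, hp0]
    exact h0.ne
  · rw [hab _ ⟨le_rfl, by linarith⟩, hT, ← travel_neg, h.position_travel, jacobi_neg, hs0]
  · rw [hab _ ⟨by linarith, le_rfl⟩, hT, h.position_travel, hs0]

theorem IsGlobalProfile.isSimple_iff (h : IsGlobalProfile R a f f₁ f₂) :
    IsSimple (disk R) (metric a) (normal a) ↔
      ∀ α ∈ Icc (-(π / 2)) (π / 2), 0 < deriv (scatteringAngle R f) α := by
  rw [← h.jacobi_neg_iff]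
  refine ⟨fun hs L S hS hLS => ?_, fun hneg =>
    ⟨h.isStrictlyConvex, h.isNonTrapping, h.not_hasConjugatePoints hneg⟩⟩
  by_contra! hj
  exact hs.2.2 (h.hasConjugatePoints hS hLS hj)

end

/-! ### The scattering relation -/

theorem norm_polar {R : ℝ} (hR : 0 ≤ R) (θ : ℝ) : ‖polar R θ‖ = R := by
  rw [← sq_eq_sq₀ (norm_nonneg _) hR, norm_sq_eq_nsq]
  simp [nsq, polar]
  linear_combination R ^ 2 * sin_sq_add_cos_sq θ

theorem polar_mem_frontier {R : ℝ} (hR : 0 < R) (θ : ℝ) : polar R θ ∈ frontier (disk R) := by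
  rw [disk, frontier_closedBall _ hR.ne', mem_sphere_zero_iff_norm, norm_polar hR.le]

theorem neg_fan (a : ℝ → ℝ) (x : Plane) (α : ℝ) : -fan a x α = fan a x (α + π) := by
  simp only [fan, cos_add_pi, sin_add_pi]
  module

section

variable {R : ℝ} {a f f₁ f₂ : ℝ → ℝ}

theorem IsGlobalProfile.profile_pos (h : IsGlobalProfile R a f f₁ f₂) :
    0 < 1 + R ^ 2 * f (R ^ 2) :=
  h.pos _ ⟨sq_nonneg R, le_rfl⟩

theorem IsGlobalProfile.er_polar (h : IsGlobalProfile R a f f₁ f₂) (θ : ℝ) :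
    er a (polar R θ) = !₂[cos θ * (1 + R ^ 2 * f (R ^ 2))⁻¹, sin θ * (1 + R ^ 2 * f (R ^ 2))⁻¹] := by
  have hR := h.radius_pos
  rw [er, norm_polar hR.le, h.eq R ⟨hR.le, le_rfl⟩]
  ext i
  fin_cases i <;> simp [polar] <;> field_simp

theorem eθ_polar (hR : 0 < R) (θ : ℝ) : eθ (polar R θ) = !₂[-sin θ, cos θ] := by
  rw [eθ, norm_polar hR.le]
  ext i
  fin_cases i <;> simp [polar] <;> field_simp

theorem IsGlobalProfile.fan_polar (h : IsGlobalProfile R a f f₁ f₂) (θ α : ℝ) :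
    fan a (polar R θ) α =
      !₂[-(cos α * (cos θ * (1 + R ^ 2 * f (R ^ 2))⁻¹)) + sin α * sin θ,
        -(cos α * (sin θ * (1 + R ^ 2 * f (R ^ 2))⁻¹)) - sin α * cos θ] := by
  rw [fan, h.er_polar, eθ_polar h.radius_pos]
  ext i
  fin_cases i <;> simp

theorem IsGlobalProfile.inn_fan_normal (h : IsGlobalProfile R a f f₁ f₂) (θ α : ℝ) :
    inn (metric a) (polar R θ) (fan a (polar R θ) α) (normal a (polar R θ)) = cos α := by
  have hR := h.radius_pos
  have hp := h.profile_pos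
  have hn : nsq (polar R θ) = R ^ 2 := by rw [← norm_sq_eq_nsq, norm_polar hR.le]
  rw [h.inn_metric (by rw [mem_disk_iff hR.le, hn]), hn, h.fan_polar, normal, h.er_polar, coeff]
  have hsc := sin_sq_add_cos_sq θ
  obtain ⟨e, he⟩ : ∃ e, e = 1 + R ^ 2 * f (R ^ 2) := ⟨_, rfl⟩
  rw [← he] at hp ⊢
  have h1 : dot !₂[-(cos α * (cos θ * e⁻¹)) + sin α * sin θ,
      -(cos α * (sin θ * e⁻¹)) - sin α * cos θ] (-!₂[cos θ * e⁻¹, sin θ * e⁻¹])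
      = cos α * e⁻¹ ^ 2 := by
    simp [dot, -inv_pow]
    linear_combination cos α * e⁻¹ ^ 2 * hsc
  have h2 : dot (polar R θ) !₂[-(cos α * (cos θ * e⁻¹)) + sin α * sin θ,
      -(cos α * (sin θ * e⁻¹)) - sin α * cos θ] = -(R * cos α * e⁻¹) := by
    simp [dot, polar]
    linear_combination -(R * cos α * e⁻¹) * hsc
  have h3 : dot (polar R θ) (-!₂[cos θ * e⁻¹, sin θ * e⁻¹]) = -(R * e⁻¹) := by
    simp [dot, polar]
    linear_combination -(R * e⁻¹) * hsc
  rw [h1, h2, h3]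
  field_simp
  rw [he]
  ring

theorem sq_sin_add_sq_cos (R α : ℝ) : (-(R * sin α)) ^ 2 + (R * cos α) ^ 2 = R ^ 2 := by
  linear_combination R ^ 2 * sin_sq_add_cos_sq α

/-- Here `s - iL = -R e^{-iα}` has argument `π - α`, whence the condition on the angle. At the exit,
`s - iL = R e^{iα}`. -/
theorem lineCurve_entry (f : ℝ → ℝ) {α φ θ : ℝ}
    (hφ : φ + phase f (-(R * sin α)) (-(R * cos α)) = θ + α - π) :
    lineCurve f (-(R * sin α)) φ (-(R * cos α)) = polar R θ := by
  have hsc := sin_sq_add_cos_sq α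
  rw [lineCurve, hφ, cos_sub_pi, sin_sub_pi, cos_add, sin_add, polar]
  ext i
  fin_cases i <;> simp
  · linear_combination R * cos θ * hsc
  · linear_combination R * sin θ * hsc

theorem IsGlobalProfile.lineVelocity_entry (h : IsGlobalProfile R a f f₁ f₂) {α φ θ : ℝ}
    (hφ : φ + phase f (-(R * sin α)) (-(R * cos α)) = θ + α - π) :
    lineVelocity f (-(R * sin α)) φ (-(R * cos α)) = fan a (polar R θ) α := by
  have hsc := sin_sq_add_cos_sq α
  have hp := h.profile_pos
  rw [lineVelocity, hφ, cos_sub_pi, sin_sub_pi, cos_add, sin_add, neg_sq (R * cos α),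
    sq_sin_add_sq_cos, h.fan_polar]
  obtain ⟨e, he⟩ : ∃ e, e = 1 + R ^ 2 * f (R ^ 2) := ⟨_, rfl⟩
  rw [← he] at hp ⊢
  ext i
  fin_cases i <;> simp <;> field_simp
  · linear_combination sin θ * sin α * (R ^ 2 * f (R ^ 2) * hsc - he)
  · linear_combination -(cos θ * sin α * (R ^ 2 * f (R ^ 2) * hsc - he))

theorem lineCurve_exit (f : ℝ → ℝ) {α φ θ : ℝ}
    (hφ : φ + phase f (-(R * sin α)) (R * cos α) = θ - α - 2 * π) :
    lineCurve f (-(R * sin α)) φ (R * cos α) = polar R θ := by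
  have hsc := sin_sq_add_cos_sq α
  rw [lineCurve, hφ, cos_sub_two_pi, sin_sub_two_pi, cos_sub, sin_sub, polar]
  ext i
  fin_cases i <;> simp
  · linear_combination R * cos θ * hsc
  · linear_combination R * sin θ * hsc

theorem IsGlobalProfile.lineVelocity_exit (h : IsGlobalProfile R a f f₁ f₂) {α φ θ : ℝ}
    (hφ : φ + phase f (-(R * sin α)) (R * cos α) = θ - α - 2 * π) :
    lineVelocity f (-(R * sin α)) φ (R * cos α) = fan a (polar R θ) (π - α) := by
  have hsc := sin_sq_add_cos_sq α
  have hp := h.profile_pos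
  rw [lineVelocity, hφ, cos_sub_two_pi, sin_sub_two_pi, cos_sub, sin_sub,
    sq_sin_add_sq_cos, h.fan_polar, cos_pi_sub, sin_pi_sub]
  obtain ⟨e, he⟩ : ∃ e, e = 1 + R ^ 2 * f (R ^ 2) := ⟨_, rfl⟩
  rw [← he] at hp ⊢
  ext i
  fin_cases i <;> simp <;> field_simp
  · linear_combination sin θ * sin α * (R ^ 2 * f (R ^ 2) * hsc - he)
  · linear_combination -(cos θ * sin α * (R ^ 2 * f (R ^ 2) * hsc - he))

/-- The time, negative for outgoing vectors, from the entry to the exit of the geodesic issued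
from the vector of angle `α`. -/
def crossingTime (R : ℝ) (f : ℝ → ℝ) (α : ℝ) : ℝ := 2 * travel R f (-(R * sin α)) (R * cos α)

theorem crossingTime_add_pi (R : ℝ) (f : ℝ → ℝ) (α : ℝ) :
    crossingTime R f (α + π) = -crossingTime R f α := by
  rw [crossingTime, crossingTime, sin_add_pi, cos_add_pi, mul_neg, mul_neg, travel_neg,
    travel_neg_left, mul_neg]

theorem IsGlobalProfile.crossingTime_nonneg (h : IsGlobalProfile R a f f₁ f₂) {α : ℝ}
    (hα : 0 ≤ cos α) : 0 ≤ crossingTime R f α := by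
  refine mul_nonneg zero_le_two ?_
  rw [← travel_zero R f (-(R * sin α))]
  exact (h.strictMono_travel _).monotone (mul_nonneg h.radius_pos.le hα)

/-- For outgoing vectors `R cos α` and the crossing time are negative, and the same formulas follow
the geodesic backwards; hence the unordered interval. -/
theorem IsGlobalProfile.exists_geodesic (h : IsGlobalProfile R a f f₁ f₂) (θ α : ℝ) :
    ∃ γ w : ℝ → Plane, IsGeodesicOn (disk R) (metric a) γ w (uIcc 0 (crossingTime R f α)) ∧
      γ 0 = polar R θ ∧ w 0 = fan a (polar R θ) α ∧
      γ (crossingTime R f α) = polar R (θ + π + 2 * scatteringAngle R f α) ∧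
      w (crossingTime R f α) =
        fan a (polar R (θ + π + 2 * scatteringAngle R f α)) (π - α) := by
  set L := -(R * sin α) with hL
  -- `φ` is forced by the argument of the starting point at abscissa `-R cos α`, and `D` is half the
  -- crossing time.
  set φ := θ + α - π + phase f L (R * cos α) with hφ
  set D := travel R f L (R * cos α) with hD
  have hT : crossingTime R f α = 2 * D := rfl
  have hentry : φ + phase f L (-(R * cos α)) = θ + α - π := by rw [phase_neg, hφ]; ring
  have hexit : φ + phase f L (R * cos α) =
      (θ + π + 2 * scatteringAngle R f α) - α - 2 * π := by rw [scatteringAngle, hφ, ← hL]; ring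
  have p0 : h.position L (0 - D) = -(R * cos α) := by
    rw [zero_sub, hD, ← travel_neg, h.position_travel]
  have p1 : h.position L (2 * D - D) = R * cos α := by
    rw [two_mul, add_sub_cancel_right, hD, h.position_travel]
  refine ⟨_, _, h.isGeodesicOn_lineCurve L φ D fun t ht => ?_, ?_, ?_, ?_, ?_⟩
  · rw [← sq_sin_add_sq_cos R α]
    have : t - D ∈ uIcc (-D) D := by
      rw [hT] at ht
      rcases mem_uIcc.1 ht with ⟨h1, h2⟩ | ⟨h1, h2⟩
      · exact mem_uIcc.2 (Or.inl ⟨by linarith, by linarith⟩)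
      · exact mem_uIcc.2 (Or.inr ⟨by linarith, by linarith⟩)
    linarith [h.position_sq_le this]
  · simp only [p0]; exact lineCurve_entry f hentry
  · simp only [p0]; exact h.lineVelocity_entry hentry
  · simp only [hT, p1]; exact lineCurve_exit f hexit
  · simp only [hT, p1]; exact h.lineVelocity_exit hexit

theorem IsGlobalProfile.momentum_fan (h : IsGlobalProfile R a f f₁ f₂) (θ α : ℝ) :
    momentum (polar R θ) (fan a (polar R θ) α) = -(R * sin α) := by
  rw [h.fan_polar]
  simp [momentum, polar]
  linear_combination -(R * sin α) * sin_sq_add_cos_sq θ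

theorem IsGlobalProfile.abscissa_fan (h : IsGlobalProfile R a f f₁ f₂) (θ α : ℝ) :
    abscissa f (polar R θ) (fan a (polar R θ) α) = -(R * cos α) := by
  have hR := h.radius_pos
  have hp := h.profile_pos
  have hn : nsq (polar R θ) = R ^ 2 := by rw [← norm_sq_eq_nsq, norm_polar hR.le]
  rw [h.fan_polar, abscissa, hn]
  have : dot (polar R θ) !₂[-(cos α * (cos θ * (1 + R ^ 2 * f (R ^ 2))⁻¹)) + sin α * sin θ,
      -(cos α * (sin θ * (1 + R ^ 2 * f (R ^ 2))⁻¹)) - sin α * cos θ]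
      = -(R * cos α * (1 + R ^ 2 * f (R ^ 2))⁻¹) := by
    simp [dot, polar]
    linear_combination -(R * cos α * (1 + R ^ 2 * f (R ^ 2))⁻¹) * sin_sq_add_cos_sq θ
  rw [this]
  field_simp

/-- The abscissa starts at `-R cos α`, and the constraint `L² + s² ≤ R²` stops it at `R cos α`; the
explicit geodesic attains this. Tangent vectors get exit time `0`. -/
theorem IsGlobalProfile.exitTime_fan (h : IsGlobalProfile R a f f₁ f₂) (θ : ℝ) {α : ℝ}
    (hα : 0 ≤ cos α) : exitTime (disk R) (metric a) (polar R θ) (fan a (polar R θ) α) =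
      ((crossingTime R f α).toNNReal : ℝ≥0∞) := by
  have hT := h.crossingTime_nonneg hα
  apply le_antisymm
  · refine iSup₂_le ?_
    rintro T ⟨γ, w, hγ, hγ0, hw0⟩
    have hT0 : (0 : ℝ) ∈ Icc 0 (T : ℝ) := ⟨le_rfl, T.2⟩
    have hT1 : (T : ℝ) ∈ Icc 0 (T : ℝ) := ⟨T.2, le_rfl⟩
    have e := h.travel_abscissa hγ (convex_Icc _ _) hT0 hT1
    have b := h.momentum_sq_add_sq_le hγ (convex_Icc _ _) hT0 hT1
    rw [hγ0, hw0, h.momentum_fan, h.abscissa_fan, travel_neg] at e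
    rw [hγ0, hw0, h.momentum_fan, ← sq_sin_add_sq_cos R α, add_le_add_iff_left] at b
    have := (abs_le_of_sq_le_sq' b (mul_nonneg h.radius_pos.le hα)).2
    have := (h.strictMono_travel (-(R * sin α))).monotone this
    rw [ENNReal.coe_le_coe]
    refine NNReal.le_toNNReal_of_coe_le ?_
    rw [crossingTime]
    linarith
  · obtain ⟨γ, w, hγ, h0, h1, -, -⟩ := h.exists_geodesic θ α
    refine le_iSup₂_of_le (crossingTime R f α).toNNReal ⟨γ, w, ?_, h0, h1⟩ le_rfl
    rwa [coe_toNNReal _ hT, ← uIcc_of_le hT]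

theorem IsGlobalProfile.isScatteringFunction (h : IsGlobalProfile R a f f₁ f₂) :
    IsScatteringFunction R a (scatteringAngle R f) where
  cont := continuous_iff_continuousAt.2 fun α => (h.hasDerivAt_scatteringAngle α).continuousAt
  zero := by simp [scatteringAngle, phase]
  scatters θ α := by
    obtain ⟨γ, w, hγ, h0, h1, h2, h3⟩ := h.exists_geodesic θ α
    refine ⟨polar_mem_frontier h.radius_pos θ, ?_, fun hα => ?_, fun hα => ?_⟩
    · rw [← h1, ← h0]
      exact (hγ 0 left_mem_uIcc).1.2
    · rw [h.inn_fan_normal] at hα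
      have hT := h.crossingTime_nonneg hα
      refine ⟨(crossingTime R f α).toNNReal, γ, w, h.exitTime_fan θ hα, ?_, h0, h1, ?_, ?_⟩
      all_goals rw [coe_toNNReal _ hT]
      · rwa [← uIcc_of_le hT]
      · exact h2
      · exact h3
    · rw [h.inn_fan_normal] at hα
      -- The reversed vector has angle `α + π` and points inward or is tangent.
      have hα' : 0 ≤ cos (α + π) := by rw [cos_add_pi]; linarith
      have hT := h.crossingTime_nonneg hα'
      refine ⟨(crossingTime R f (α + π)).toNNReal, γ, w, ?_, ?_, h0, h1, ?_, ?_⟩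
      · rw [neg_fan]; exact h.exitTime_fan θ hα'
      all_goals rw [coe_toNNReal _ hT, crossingTime_add_pi, neg_neg]
      · rw [crossingTime_add_pi] at hT
        rwa [← uIcc_of_ge (by linarith)]
      · exact h2
      · exact h3

/-! ### Uniqueness of the scattering function -/

/-- The exit point is determined by the scattering relation. -/
theorem IsGlobalProfile.eq_of_scatters (h : IsGlobalProfile R a f f₁ f₂) {x v x' v' y' w' : Plane}
    (h₁ : Scatters (disk R) (metric a) (normal a) x v x' v')
    (h₂ : Scatters (disk R) (metric a) (normal a) x v y' w') : x' = y' := by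
  rcases le_total 0 (inn (metric a) x v (normal a x)) with hc | hc
  · obtain ⟨T, γ, w, hT, hγ, h0, h1, h2, -⟩ := h₁.2.2.1 hc
    obtain ⟨T', γ', w', hT', hγ', h0', h1', h2', -⟩ := h₂.2.2.1 hc
    obtain rfl : T = T' := ENNReal.coe_injective (hT.symm.trans hT')
    rw [← h2, ← h2']
    exact h.geodesic_eq hγ hγ' (convex_Icc _ _) ⟨le_rfl, T.2⟩ ⟨T.2, le_rfl⟩ (h0.trans h0'.symm)
      (h1.trans h1'.symm)
  · obtain ⟨T, γ, w, hT, hγ, h0, h1, h2, -⟩ := h₁.2.2.2 hc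
    obtain ⟨T', γ', w', hT', hγ', h0', h1', h2', -⟩ := h₂.2.2.2 hc
    obtain rfl : T = T' := ENNReal.coe_injective (hT.symm.trans hT')
    rw [← h2, ← h2']
    have := T.coe_nonneg
    exact h.geodesic_eq hγ hγ' (convex_Icc _ _) ⟨by linarith, le_rfl⟩ ⟨le_rfl, by linarith⟩
      (h0.trans h0'.symm) (h1.trans h1'.symm)

theorem exists_int_of_polar_eq (hR : 0 < R) {θ θ' : ℝ} (hp : polar R θ = polar R θ') :
    ∃ n : ℤ, θ = θ' + n * (2 * π) := by
  have hc : cos θ = cos θ' := by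
    have := congr_arg (fun x : Plane => x 0) hp
    simpa [polar, hR.ne'] using this
  have hs : sin θ = sin θ' := by
    have := congr_arg (fun x : Plane => x 1) hp
    simpa [polar, hR.ne'] using this
  have h1 : cos (θ - θ') = 1 := by
    rw [cos_sub, hc, hs]
    linear_combination sin_sq_add_cos_sq θ'
  obtain ⟨n, hn⟩ := (cos_eq_one_iff _).1 h1
  exact ⟨n, by linarith⟩

/-- Equality of exit points makes the difference an integer multiple of `π`; being continuous and
zero at `0`, it vanishes. -/
theorem IsGlobalProfile.scatteringFunction_eq (h : IsGlobalProfile R a f f₁ f₂) {ς : ℝ → ℝ}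
    (hς : IsScatteringFunction R a ς) : ς = scatteringAngle R f := by
  have hs := h.isScatteringFunction
  have key : ∀ α, ∃ n : ℤ, (ς α - scatteringAngle R f α) / π = n := fun α => by
    obtain ⟨n, hn⟩ := exists_int_of_polar_eq h.radius_pos
      (h.eq_of_scatters (hς.scatters 0 α) (hs.scatters 0 α))
    refine ⟨n, ?_⟩
    field_simp
    linarith
  have hc : Continuous fun α => (ς α - scatteringAngle R f α) / π :=
    (hς.cont.sub hs.cont).div_const π
  have h0 : (ς 0 - scatteringAngle R f 0) / π = 0 := by rw [hς.zero, hs.zero]; simp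
  -- The half-integers `±1/2` are the levels that a nonzero integer value would force by the
  -- intermediate value theorem.
  have no : ∀ β, (ς β - scatteringAngle R f β) / π ≠ 1 / 2 ∧
      (ς β - scatteringAngle R f β) / π ≠ -(1 / 2) := fun β => by
    obtain ⟨n, hn⟩ := key β
    rw [hn]
    constructor <;> intro e
    · have : ((2 * n : ℤ) : ℝ) = (1 : ℤ) := by push_cast; linarith
      have := Int.cast_injective this
      omega
    · have : ((2 * n : ℤ) : ℝ) = (-1 : ℤ) := by push_cast; linarith
      have := Int.cast_injective this
      omega
  funext α
  obtain ⟨n, hn⟩ := key α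
  have hn0 : n = 0 := by
    by_contra hne
    rcases lt_or_gt_of_ne hne with hlt | hgt
    · have : (n : ℝ) ≤ -1 := by exact_mod_cast Int.le_sub_one_of_lt hlt
      obtain ⟨β, hβ⟩ := mem_range_of_exists_le_of_exists_ge (c := -(1 / 2)) hc
        ⟨α, by rw [hn]; linarith⟩ ⟨0, by rw [h0]; norm_num⟩
      exact (no β).2 hβ
    · have : (1 : ℝ) ≤ n := by exact_mod_cast hgt
      obtain ⟨β, hβ⟩ := mem_range_of_exists_le_of_exists_ge (c := 1 / 2) hc
        ⟨0, by rw [h0]; norm_num⟩ ⟨α, by rw [hn]; linarith⟩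
      exact (no β).1 hβ
  rw [hn0, Int.cast_zero, div_eq_zero_iff, or_iff_left pi_ne_zero] at hn
  linarith

end

end Herglotz

end

theorem proposition3 (R : ℝ) (a : ℝ → ℝ) (ha : Herglotz.IsHerglotzProfile R a) :
    (∃! ς : ℝ → ℝ, Herglotz.IsScatteringFunction R a ς) ∧
    ∀ ς : ℝ → ℝ, Herglotz.IsScatteringFunction R a ς →
      Differentiable ℝ ς ∧
      (Herglotz.IsSimple (Herglotz.disk R) (Herglotz.metric a) (Herglotz.normal a) ↔
        ∀ α ∈ Set.Icc (-(Real.pi / 2)) (Real.pi / 2), 0 < deriv ς α) := by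
  obtain ⟨f, f₁, f₂, h⟩ := ha.exists_isGlobalProfile
  refine ⟨⟨_, h.isScatteringFunction, fun ς hς => h.scatteringFunction_eq hς⟩, fun ς hς => ?_⟩
  rw [h.scatteringFunction_eq hς]
  exact ⟨fun α => (h.hasDerivAt_scatteringAngle α).differentiableAt, h.isSimple_iff⟩
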